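/- Let $\mathcal H$ be a complex Hilbert space of dimension $2$ (a qubit) and let $I$ be a finite set with at least two elements. A POVM on $\mathcal H$ with outcomes in $I$ is a family $\mathbf P=(P_i)_{i\in I}$ of non-negative operators on $\mathcal H$ with $\sum_{i\in I}P_i=\mathbf 1$. A channel is a completely positive linear map $\mathcal E$ from $\mathcal B(\mathcal H)$ to itself with $\mathcal E(\mathbf 1)=\mathbf 1$. For POVMs $\mathbf P,\mathbf Q$ with outcomes in $I$, $\mathbf P$ is cleaner than $\mathbf Q$, written $\mathbf P\succ\mathbf Q$, if there is a channel $\mathcal E$ with $\mathcal E(P_i)=Q_i$ for all $i\in I$. $\mathbf P$ is clean if every POVM $\mathbf Q$ with $\mathbf Q\succ\mathbf P$ satisfies $\mathbf P\succ\mathbf Q$. $\mathbf P$ and $\mathbf Q$ are cleanness-equivalent if $\mathbf P\succ\mathbf Q$ and $\mathbf Q\succ\mathbf P$, and unitarily equivalent if there is a unitary $U$ with $UP_iU^*=Q_i$ for all $i\in I$. $\mathbf P$ is rank-one if all its non-zero elements have rank one. The support of a non-negative operator $A$ is the subspace whose orthogonal is $\{\varphi:\langle\varphi,A\varphi\rangle=0\}$.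 Three vectors of $\mathcal H$ form a projective frame if any two of them form a basis of $\mathcal H$. Let $\mathbf P$ be a POVM on $\mathcal H$ with outcomes in $I$. Then: (1) $\mathbf P$ is clean if and only if it is rank-one or it has three rank-one elements whose supports are pairwise non-collinear lines. (2) The supports of three rank-one elements of $\mathbf P$ are pairwise non-collinear if and only if they are spanned by the vectors of a projective frame. (3) If $\mathbf P$ is clean then, for every POVM $\mathbf Q$ with outcomes in $I$, $\mathbf P$ and $\mathbf Q$ are cleanness-equivalent if and only if they are unitarily equivalent. -/

import Mathlib

/-- A positive operator valued measure on the Hilbert space `H` with outcomes in the finite type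
`I`: a family of non-negative operators on `H` that sums to the identity. -/
structure POVM (H : Type*) [NormedAddCommGroup H] [InnerProductSpace ℂ H] [CompleteSpace H]
    (I : Type*) [Fintype I] where
  elem : I → (H →L[ℂ] H)
  isPositive : ∀ i, (elem i).IsPositive
  sum_eq_one : ∑ i, elem i = 1

/-- A channel (in the Heisenberg picture) on the operators of `H`: a completely positive,
identity-preserving linear map. -/
structure QChannel (H : Type*) [NormedAddCommGroup H] [InnerProductSpace ℂ H] [CompleteSpace H]
    where
  toMap : CompletelyPositiveMap (H →L[ℂ] H) (H →L[ℂ] H)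
  map_one : toMap 1 = 1

/-- A projective frame of `V`: a family of `dim V + 1` vectors such that any `dim V` of them form
a basis of `V`. -/
def IsProjectiveFrame {V : Type*} [AddCommGroup V] [Module ℂ V] {ι : Type*} [Fintype ι]
    (v : ι → V) : Prop :=
  Fintype.card ι = Module.finrank ℂ V + 1 ∧
    ∀ s : Finset ι, s.card = Module.finrank ℂ V →
      LinearIndependent ℂ (fun x : s => v x) ∧ Submodule.span ℂ (v '' (s : Set ι)) = ⊤

/-- Two lines are non-collinear: non-zero vectors of the one and of the other are linearly
independent. -/
def NonCollinear {V : Type*} [AddCommGroup V] [Module ℂ V] (K L : Submodule ℂ V) : Prop :=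
  ∀ v ∈ K, ∀ w ∈ L, v ≠ 0 → w ≠ 0 → LinearIndependent ℂ ![v, w]

/-- The support of a non-negative operator `A`: the orthogonal of the set of the vectors `φ` with
`⟨φ, A φ⟩ = 0`. -/
noncomputable def operatorSupport {H : Type*} [NormedAddCommGroup H] [InnerProductSpace ℂ H]
    (A : H →L[ℂ] H) : Submodule ℂ H :=
  (Submodule.span ℂ {φ : H | inner ℂ φ (A φ) = 0})ᗮ

/-- An operator of rank one. -/
def IsRankOneOperator {H : Type*} [NormedAddCommGroup H] [InnerProductSpace ℂ H]
    (A : H →L[ℂ] H) : Prop :=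
  Module.finrank ℂ (LinearMap.range (A : H →ₗ[ℂ] H)) = 1

namespace POVM

/-- `P` is cleaner than `Q`: some channel maps every element of `P` to the corresponding element
of `Q`. -/
def IsCleaner {H : Type*} [NormedAddCommGroup H] [InnerProductSpace ℂ H] [CompleteSpace H]
    {I : Type*} [Fintype I] (P Q : POVM H I) : Prop :=
  ∃ E : QChannel H, ∀ i, E.toMap (P.elem i) = Q.elem i

/-- `P` is clean: whenever `Q` is cleaner than `P`, also `P` is cleaner than `Q`. -/
def IsClean {H : Type*} [NormedAddCommGroup H] [InnerProductSpace ℂ H] [CompleteSpace H]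
    {I : Type*} [Fintype I] (P : POVM H I) : Prop :=
  ∀ Q : POVM H I, Q.IsCleaner P → P.IsCleaner Q

/-- Each of the two POVMs is cleaner than the other. -/
def CleannessEquivalent {H : Type*} [NormedAddCommGroup H] [InnerProductSpace ℂ H]
    [CompleteSpace H] {I : Type*} [Fintype I] (P Q : POVM H I) : Prop :=
  Q.IsCleaner P ∧ P.IsCleaner Q

/-- `Q i = U (P i) U*` for all `i`, for one unitary operator `U`. -/
def UnitarilyEquivalent {H : Type*} [NormedAddCommGroup H] [InnerProductSpace ℂ H]
    [CompleteSpace H] {I : Type*} [Fintype I] (P Q : POVM H I) : Prop :=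
  ∃ U ∈ unitary (H →L[ℂ] H), ∀ i, U * P.elem i * star U = Q.elem i

/-- A rank-one POVM: all its elements have rank one. Outcomes that never occur (elements equal
to `0`) are disregarded. -/
def IsRankOne {H : Type*} [NormedAddCommGroup H] [InnerProductSpace ℂ H] [CompleteSpace H]
    {I : Type*} [Fintype I] (P : POVM H I) : Prop :=
  ∀ i, P.elem i ≠ 0 → IsRankOneOperator (P.elem i)

/-- The outcomes `t 0`, `t 1`, `t 2` have rank-one elements with pairwise non-collinear
supports. -/
def IsNonCollinearTriple {H : Type*} [NormedAddCommGroup H] [InnerProductSpace ℂ H]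
    [CompleteSpace H] {I : Type*} [Fintype I] (P : POVM H I) (t : Fin 3 → I) : Prop :=
  (∀ a, IsRankOneOperator (P.elem (t a))) ∧
    ∀ a b, a ≠ b →
      NonCollinear (operatorSupport (P.elem (t a))) (operatorSupport (P.elem (t b)))

/-- The outcomes `t 0`, `t 1`, `t 2` have rank-one elements whose supports are spanned by the
vectors of a projective frame. -/
def IsFrameTriple {H : Type*} [NormedAddCommGroup H] [InnerProductSpace ℂ H]
    [CompleteSpace H] {I : Type*} [Fintype I] (P : POVM H I) (t : Fin 3 → I) : Prop :=
  (∀ a, IsRankOneOperator (P.elem (t a))) ∧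
    ∃ v : Fin 3 → H, (∀ a, operatorSupport (P.elem (t a)) = Submodule.span ℂ {v a}) ∧
      IsProjectiveFrame v

end POVM

/-! The basic dichotomy is that a non-negative operator on a qubit is either positive definite or of
the form `ψψ*` (`isPosDef_or_eq_rankOne`). A channel preserves positive definiteness, so whatever it
maps to some `φφ*` was already of that form.

Sufficiency is rigidity: if `Q` is cleaner than `P`, the two are unitarily equivalent. For a
non-collinear triple, complete positivity determines the channel on the off-diagonal `ψ₀ψ₁*` up to
one scalar, and the third vector fixes that scalar (`QChannel.exists_unitary`). A rank-one POVM
without such a triple lives on two lines; grouping its outcomes by line reduces it to a pair of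
orthogonal projections. Rigidity also yields the third claim.

For necessity, suppose that `P` is clean, has a positive definite element and has no triple. Its
rank-one elements then lie on two lines, and the reflection `Z` that fixes one line and negates the
other leaves them invariant under `X ↦ Z X Z*`. Any family `q` with positive definite sum can be
normalized to a POVM, so if a two-Kraus map sends `q` to `P`, cleanness forbids `q i` to be singular
where `P i` is positive definite (`POVM.IsClean.isPosDef_of_kraus`). Amplifying the part of `P` that
is odd under `Z` would create such a singular element, hence `P` is `Z`-invariant. An invariant
positive definite element is in turn the image of a singular one, a contradiction. -/

open InnerProductSpace

/-! ### Completely positive maps and Kraus channels -/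

section Channels

variable {H : Type*} [NormedAddCommGroup H] [InnerProductSpace ℂ H] [CompleteSpace H]

lemma CStarAlgebra.nonneg_iff_exists_star_mul_self {A : Type*} [NonUnitalCStarAlgebra A]
    [PartialOrder A] [StarOrderedRing A] (a : A) : 0 ≤ a ↔ ∃ b, a = star b * b :=
  CStarAlgebra.nonneg_iff_eq_star_mul_self

/-- Non-negative matrices over a C⋆-algebra are the Gram matrices. -/
lemma CStarMatrix.nonneg_iff_gram {A : Type*} [NonUnitalCStarAlgebra A]
    [PartialOrder A] [StarOrderedRing A] {n : Type*} [Fintype n] (M : CStarMatrix n n A) :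
    0 ≤ M ↔ ∃ B : n → n → A, ∀ i j, M i j = ∑ k, star (B k i) * B k j := by
  rw [CStarAlgebra.nonneg_iff_exists_star_mul_self]
  constructor
  · rintro ⟨B, rfl⟩
    refine ⟨fun i j => B i j, fun i j => ?_⟩
    simp only [CStarMatrix.mul_apply, CStarMatrix.star_apply]
  · rintro ⟨B, hB⟩
    refine ⟨CStarMatrix.ofMatrix B, ?_⟩
    ext1 i j
    simp only [CStarMatrix.mul_apply, CStarMatrix.star_apply]
    exact hB i j

/-- Conjugation by `V` as a completely positive map. -/
noncomputable def conjCP (V : H →L[ℂ] H) : CompletelyPositiveMap (H →L[ℂ] H) (H →L[ℂ] H) where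
  toFun X := V * X * star V
  map_add' X Y := by rw [mul_add, add_mul]
  map_smul' c X := by simp
  map_cstarMatrix_nonneg' k M hM := by
    rw [CStarMatrix.nonneg_iff_gram] at hM ⊢
    obtain ⟨B, hB⟩ := hM
    refine ⟨fun i j => B i j * star V, fun i j => ?_⟩
    rw [CStarMatrix.map_apply, hB]
    simp [mul_assoc]

@[simp] lemma conjCP_apply (V X : H →L[ℂ] H) : conjCP V X = V * X * star V := rfl

/-- The sum of two completely positive maps. -/
noncomputable def addCP (E F : CompletelyPositiveMap (H →L[ℂ] H) (H →L[ℂ] H)) :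
    CompletelyPositiveMap (H →L[ℂ] H) (H →L[ℂ] H) where
  toLinearMap := E.toLinearMap + F.toLinearMap
  map_cstarMatrix_nonneg' k M hM := by
    have h := add_nonneg (E.map_cstarMatrix_nonneg' k M hM) (F.map_cstarMatrix_nonneg' k M hM)
    convert h using 1
    ext1 i j
    rfl

@[simp] lemma addCP_apply (E F : CompletelyPositiveMap (H →L[ℂ] H) (H →L[ℂ] H)) (X : H →L[ℂ] H) :
    addCP E F X = E X + F X := rfl

/-- The Gram representation of the images of `ψᵢ ψⱼ*` under a completely positive map. -/
lemma exists_gram (E : CompletelyPositiveMap (H →L[ℂ] H) (H →L[ℂ] H)) {n : ℕ} (ψ : Fin n → H) :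
    ∃ B : Fin n → Fin n → (H →L[ℂ] H),
      ∀ i j, E (rankOne ℂ (ψ i) (ψ j)) = ∑ k, star (B k i) * B k j := by
  rcases n with _ | n
  · exact ⟨fun _ _ => 0, fun i => i.elim0⟩
  by_cases hψ : ∃ η : H, ‖η‖ = 1
  · obtain ⟨η, hη⟩ := hψ
    have hM : (0 : CStarMatrix (Fin (n + 1)) (Fin (n + 1)) (H →L[ℂ] H)) ≤
        CStarMatrix.ofMatrix fun i j => rankOne ℂ (ψ i) (ψ j) := by
      rw [CStarMatrix.nonneg_iff_gram]
      -- As `η` is a unit vector, `(η ψᵢ*)* (η ψⱼ*) = ψᵢψⱼ*`: one non-zero row suffices.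
      refine ⟨fun i j => if i = 0 then rankOne ℂ η (ψ j) else 0, fun i j => ?_⟩
      rw [Finset.sum_eq_single 0]
      · simp only [if_true, ContinuousLinearMap.star_eq_adjoint, ContinuousLinearMap.mul_def,
          adjoint_rankOne, rankOne_comp_rankOne]
        simp [hη]
        rfl
      · intro b _ hb
        simp [hb]
      · simp
    exact (CStarMatrix.nonneg_iff_gram _).1 (E.map_cstarMatrix_nonneg' _ _ hM)
  · have h0 : ∀ x : H, x = 0 := by
      intro x
      by_contra hx
      exact hψ ⟨(‖x‖⁻¹ : ℂ) • x, by simp [norm_smul, hx]⟩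
    refine ⟨fun _ _ => 0, fun i j => ?_⟩
    ext x
    exact (h0 _).trans (h0 _).symm

lemma cp_mono (E : CompletelyPositiveMap (H →L[ℂ] H) (H →L[ℂ] H)) {X Y : H →L[ℂ] H} (h : X ≤ Y) :
    E X ≤ E Y := OrderHomClass.mono E h

/-- The channel `X ↦ A X A* + B X B*`. -/
noncomputable def twoKrausChannel (A B : H →L[ℂ] H) (h : A * star A + B * star B = 1) :
    QChannel H where
  toMap := addCP (conjCP A) (conjCP B)
  map_one := by simpa using h

@[simp] lemma twoKrausChannel_apply (A B : H →L[ℂ] H) (h : A * star A + B * star B = 1)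
    (X : H →L[ℂ] H) :
    (twoKrausChannel A B h).toMap X = A * X * star A + B * X * star B := rfl

lemma POVM.UnitarilyEquivalent.symm {I : Type*} [Fintype I] {P Q : POVM H I}
    (h : P.UnitarilyEquivalent Q) : Q.UnitarilyEquivalent P := by
  obtain ⟨U, hU, h⟩ := h
  refine ⟨star U, Unitary.star_mem hU, fun i => ?_⟩
  rw [← h i, star_star]
  calc star U * (U * P.elem i * star U) * U = (star U * U) * P.elem i * (star U * U) := by
        simp only [mul_assoc]
    _ = P.elem i := by rw [Unitary.star_mul_self_of_mem hU]; simp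

lemma POVM.UnitarilyEquivalent.isCleaner {I : Type*} [Fintype I] {P Q : POVM H I}
    (h : P.UnitarilyEquivalent Q) : P.IsCleaner Q := by
  obtain ⟨U, hU, h⟩ := h
  refine ⟨⟨conjCP U, ?_⟩, h⟩
  simpa using Unitary.mul_star_self_of_mem hU

end Channels

/-! ### Positive and rank-one operators on a qubit -/

section Operators

variable {H : Type*} [NormedAddCommGroup H] [InnerProductSpace ℂ H]

/-- An operator bounded below by a positive multiple of the identity. -/
def IsPosDef (A : H →L[ℂ] H) : Prop := ∃ ε : ℝ, 0 < ε ∧ (ε : ℂ) • (1 : H →L[ℂ] H) ≤ A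

lemma rankOne_smul_smul (c d : ℂ) (x y : H) :
    rankOne ℂ (c • x) (d • y) = (c * (starRingEnd ℂ) d) • rankOne ℂ x y := by
  ext z
  simp [smul_smul, mul_comm]

lemma IsPosDef.mono {A B : H →L[ℂ] H} (hA : IsPosDef A) (h : A ≤ B) : IsPosDef B := by
  obtain ⟨ε, hε, hle⟩ := hA
  exact ⟨ε, hε, hle.trans h⟩

lemma IsPosDef.re_inner_pos {A : H →L[ℂ] H} (hA : IsPosDef A) {x : H} (hx : x ≠ 0) :
    0 < (inner ℂ x (A x)).re := by
  obtain ⟨ε, hε, hle⟩ := hA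
  have h := ((ContinuousLinearMap.le_def _ _).1 hle).re_inner_nonneg_right x
  have h1 : (inner ℂ x (((ε : ℂ) • (1 : H →L[ℂ] H)) x)).re = ε * ‖x‖ ^ 2 := by
    rw [smul_apply, one_apply_eq_self, inner_smul_right, inner_self_eq_norm_sq_to_K]
    rw [← RCLike.ofReal_pow]
    exact (Complex.ofReal_mul ε (‖x‖ ^ 2) ▸ Complex.ofReal_re (ε * ‖x‖ ^ 2))
  rw [sub_apply, inner_sub_right, map_sub] at h
  simp only [RCLike.re_eq_complex_re] at h
  rw [h1] at h
  have : 0 < ε * ‖x‖ ^ 2 := by positivity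
  linarith

lemma IsPosDef.nonneg {A : H →L[ℂ] H} (hA : IsPosDef A) : 0 ≤ A := by
  obtain ⟨ε, hε, hle⟩ := hA
  refine le_trans ?_ hle
  rw [ContinuousLinearMap.nonneg_iff_isPositive]
  exact ContinuousLinearMap.isPositive_one.smul_of_nonneg (by exact_mod_cast hε.le)

lemma isPosDef_one : IsPosDef (1 : H →L[ℂ] H) := ⟨1, one_pos, by simp⟩

/-- A channel is monotone and unital, so the same lower bound `ε` survives. Read backwards,
singularity passes from the image to the preimage. -/
lemma IsPosDef.cp [CompleteSpace H] {A : H →L[ℂ] H} (hA : IsPosDef A) (E : QChannel H) :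
    IsPosDef (E.toMap A) := by
  obtain ⟨ε, hε, hle⟩ := hA
  refine ⟨ε, hε, ?_⟩
  have := cp_mono E.toMap hle
  rwa [map_smul, E.map_one] at this

/-- Turns positivity into inequalities affine in `t`; closedness and boundedness of the set of
admissible `t` can then be read off. -/
lemma isPositive_add_smul_iff {A D : H →L[ℂ] H} (hA : A.IsSymmetric) (hD : D.IsSymmetric)
    (t : ℝ) : (A + (t : ℂ) • D).IsPositive ↔
      ∀ x, 0 ≤ (inner ℂ (A x) x).re + t * (inner ℂ (D x) x).re := by
  have h7 : ∀ x, (A + (t : ℂ) • D).reApplyInnerSelf x =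
      (inner ℂ (A x) x).re + t * (inner ℂ (D x) x).re := by
    intro x
    simp only [ContinuousLinearMap.reApplyInnerSelf_apply, add_apply, smul_apply,
      inner_add_left, inner_smul_left, map_add, Complex.conj_ofReal, RCLike.re_eq_complex_re,
      Complex.re_ofReal_mul]
  constructor
  · intro h x
    rw [← h7]
    exact h.re_inner_nonneg_left x
  · intro h
    refine ⟨fun x y => ?_, fun x => ?_⟩
    · have h1 := hA x y
      have h2 := hD x y
      simp only [ContinuousLinearMap.coe_coe] at h1 h2
      simp only [ContinuousLinearMap.coe_coe, add_apply, smul_apply, inner_add_left,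
        inner_add_right, inner_smul_left, inner_smul_right, h1, h2, Complex.conj_ofReal]
    · rw [h7]
      exact h x

lemma IsPosDef.exists_perturbation {A B : H →L[ℂ] H} (hA : IsPosDef A)
    (hAs : A.IsPositive) (hB : B.IsSymmetric) :
    ∃ δ : ℝ, 0 < δ ∧ ∀ t : ℝ, |t| < δ → 0 ≤ A + (t : ℂ) • B := by
  obtain ⟨ε, hε, hle⟩ := hA
  -- The summand 1 keeps the denominator positive when `B = 0`.
  refine ⟨ε / (‖B‖ + 1), by positivity, fun t ht => ?_⟩
  rw [ContinuousLinearMap.nonneg_iff_isPositive,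
    isPositive_add_smul_iff hAs.isSymmetric hB]
  intro x
  have h := ((ContinuousLinearMap.le_def _ _).1 hle).re_inner_nonneg_left x
  have h1 : (inner ℂ (((ε : ℂ) • (1 : H →L[ℂ] H)) x) x).re = ε * ‖x‖ ^ 2 := by
    rw [smul_apply, one_apply_eq_self, inner_smul_left, inner_self_eq_norm_sq_to_K]
    rw [← RCLike.ofReal_pow, Complex.conj_ofReal]
    exact (Complex.ofReal_mul ε (‖x‖ ^ 2) ▸ Complex.ofReal_re (ε * ‖x‖ ^ 2))
  rw [sub_apply, inner_sub_left, map_sub] at h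
  simp only [RCLike.re_eq_complex_re] at h
  rw [h1] at h
  have h2 : ‖inner ℂ (B x) x‖ ≤ ‖B‖ * ‖x‖ ^ 2 := by
    refine (norm_inner_le_norm _ _).trans ?_
    rw [pow_two, ← mul_assoc]
    gcongr
    exact B.le_opNorm x
  have h3 : |(inner ℂ (B x) x).re| ≤ ‖B‖ * ‖x‖ ^ 2 := (Complex.abs_re_le_norm _).trans h2
  have h4 : |t * (inner ℂ (B x) x).re| ≤ ε * ‖x‖ ^ 2 := by
    rw [abs_mul]
    have h5 : |t| * (‖B‖ + 1) ≤ ε := by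
      rw [lt_div_iff₀ (by positivity)] at ht
      exact ht.le
    calc |t| * |(inner ℂ (B x) x).re| ≤ |t| * (‖B‖ * ‖x‖ ^ 2) := by gcongr
      _ ≤ |t| * (‖B‖ + 1) * ‖x‖ ^ 2 := by
        rw [mul_assoc]
        gcongr
        linarith
      _ ≤ ε * ‖x‖ ^ 2 := by gcongr
  have h6 := (abs_le.1 h4).1
  linarith

lemma mem_span_of_forall_orthogonal {χ ψ : H} (h : ∀ y, inner ℂ ψ y = 0 → inner ℂ χ y = 0) :
    χ ∈ Submodule.span ℂ {ψ} := by
  rw [← Submodule.orthogonal_orthogonal (Submodule.span ℂ {ψ}), Submodule.mem_orthogonal']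
  intro y hy
  exact h y ((Submodule.mem_orthogonal_singleton_iff_inner_right).1 hy)

/-- An operator annihilating `g^⊥` with range in the line of `f` is a multiple of `f g*`. -/
lemma exists_eq_smul_rankOne {A : H →L[ℂ] H} {f g : H}
    (hf : ∀ x y, inner ℂ f x = 0 → inner ℂ x (A y) = 0) (hg : ∀ y, inner ℂ g y = 0 → A y = 0)
    (hg0 : g ≠ 0) : ∃ b : ℂ, A = b • rankOne ℂ f g := by
  have hgg : inner ℂ g g ≠ 0 := inner_self_ne_zero.2 hg0
  obtain ⟨c, hc⟩ := Submodule.mem_span_singleton.1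
    (mem_span_of_forall_orthogonal (χ := A g) (ψ := f) fun y hy =>
      inner_eq_zero_symm.1 (hf y g hy))
  refine ⟨c / inner ℂ g g, ?_⟩
  ext y
  have h1 : A (y - (inner ℂ g y / inner ℂ g g) • g) = 0 := by
    apply hg
    rw [inner_sub_right, inner_smul_right, div_mul_cancel₀ _ hgg, sub_self]
  rw [map_sub, map_smul, sub_eq_zero, ← hc, smul_smul] at h1
  rw [h1, smul_apply, rankOne_apply, smul_smul]
  congr 1
  ring

lemma isRankOneOperator_rankOne {ψ : H} (hψ : ψ ≠ 0) : IsRankOneOperator (rankOne ℂ ψ ψ) := by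
  have : LinearMap.range ((rankOne ℂ ψ ψ : H →L[ℂ] H) : H →ₗ[ℂ] H) = Submodule.span ℂ {ψ} := by
    ext x
    simp only [LinearMap.mem_range, ContinuousLinearMap.coe_coe, rankOne_apply,
      Submodule.mem_span_singleton]
    constructor
    · rintro ⟨y, hy⟩
      exact ⟨_, hy⟩
    · rintro ⟨c, hc⟩
      refine ⟨(c / inner ℂ ψ ψ) • ψ, ?_⟩
      rw [inner_smul_right, div_mul_cancel₀ _ (inner_self_ne_zero.2 hψ), hc]
  rw [IsRankOneOperator, this, finrank_span_singleton hψ]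

lemma operatorSupport_rankOne (ψ : H) :
    operatorSupport (rankOne ℂ ψ ψ) = Submodule.span ℂ {ψ} := by
  have : {φ : H | inner ℂ φ ((rankOne ℂ ψ ψ : H →L[ℂ] H) φ) = 0} =
      ((Submodule.span ℂ {ψ})ᗮ : Submodule ℂ H) := by
    ext φ
    rw [Set.mem_ofPred_eq, SetLike.mem_coe, Submodule.mem_orthogonal_singleton_iff_inner_right,
      rankOne_apply, inner_smul_right, mul_eq_zero, inner_eq_zero_symm (x := φ), or_self]
  rw [operatorSupport, this, Submodule.span_eq, Submodule.orthogonal_orthogonal]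

lemma nonCollinear_span_singleton {V : Type*} [AddCommGroup V] [Module ℂ V] {ψ χ : V}
    (hψ : ψ ≠ 0) (hχ : χ ≠ 0) :
    NonCollinear (Submodule.span ℂ {ψ}) (Submodule.span ℂ {χ}) ↔
      LinearIndependent ℂ ![ψ, χ] := by
  refine ⟨fun h => h ψ (Submodule.mem_span_singleton_self ψ) χ
    (Submodule.mem_span_singleton_self χ) hψ hχ, fun h v hv w hw hv0 hw0 => ?_⟩
  obtain ⟨a, rfl⟩ := Submodule.mem_span_singleton.1 hv
  obtain ⟨b, rfl⟩ := Submodule.mem_span_singleton.1 hw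
  have ha : a ≠ 0 := fun h => hv0 (by rw [h, zero_smul])
  have hb : b ≠ 0 := fun h => hw0 (by rw [h, zero_smul])
  rw [LinearIndependent.pair_iff] at h ⊢
  intro s t hst
  rw [smul_smul, smul_smul] at hst
  simpa [ha, hb] using h _ _ hst

section FiniteDim

lemma finiteDimensional_of_finrank_eq_two (hH : Module.finrank ℂ H = 2) : FiniteDimensional ℂ H :=
  FiniteDimensional.of_finrank_pos (by omega)

lemma exists_orthogonal (hH : Module.finrank ℂ H = 2) (ψ : H) :
    ∃ x : H, x ≠ 0 ∧ inner ℂ ψ x = 0 := by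
  have := finiteDimensional_of_finrank_eq_two hH
  have h1 := Submodule.finrank_add_finrank_orthogonal (Submodule.span ℂ {ψ})
  have h2 : Module.finrank ℂ (Submodule.span ℂ {ψ}) ≤ 1 := by
    simpa using finrank_span_le_card (R := ℂ) ({ψ} : Set H)
  have h3 : (Submodule.span ℂ {ψ})ᗮ ≠ ⊥ := by
    intro h
    rw [h, finrank_bot] at h1
    omega
  obtain ⟨x, hx, hx0⟩ := Submodule.exists_mem_ne_zero_of_ne_bot h3
  exact ⟨x, hx0, Submodule.mem_orthogonal_singleton_iff_inner_right.1 hx⟩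

lemma not_isPosDef_rankOne (hH : Module.finrank ℂ H = 2) (ψ : H) :
    ¬ IsPosDef (rankOne ℂ ψ ψ : H →L[ℂ] H) := by
  intro h
  obtain ⟨x, hx, hxψ⟩ := exists_orthogonal hH ψ
  simpa [hxψ] using h.re_inner_pos hx

/-- The spectral decomposition of a positive operator on a qubit. -/
lemma exists_spectral (hH : Module.finrank ℂ H = 2) {A : H →L[ℂ] H} (hA : A.IsPositive) :
    ∃ (e : OrthonormalBasis (Fin 2) ℂ H) (l : Fin 2 → ℝ), (∀ i, 0 ≤ l i) ∧
      A = (l 0 : ℂ) • rankOne ℂ (e 0) (e 0) + (l 1 : ℂ) • rankOne ℂ (e 1) (e 1) := by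
  have := finiteDimensional_of_finrank_eq_two hH
  let e := hA.isSymmetric.eigenvectorBasis hH
  have he : ∀ i, A (e i) = (hA.isSymmetric.eigenvalues hH i : ℂ) • e i := fun i =>
    hA.isSymmetric.apply_eigenvectorBasis hH i
  refine ⟨e, hA.isSymmetric.eigenvalues hH, fun i => ?_, ?_⟩
  · have h := hA.re_inner_nonneg_right (e i)
    rw [he, inner_smul_right, inner_self_eq_norm_sq_to_K, e.orthonormal.1] at h
    simpa using h
  · ext x
    have h1 := congrArg A (e.sum_repr' x)
    rw [map_sum] at h1
    rw [← h1, Fin.sum_univ_two]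
    simp only [map_smul, he, add_apply, smul_apply, rankOne_apply, smul_smul, mul_comm]

lemma OrthonormalBasis.rankOne_add_rankOne_eq_one (e : OrthonormalBasis (Fin 2) ℂ H) :
    rankOne ℂ (e 0) (e 0) + rankOne ℂ (e 1) (e 1) = (1 : H →L[ℂ] H) := by
  rw [← Fin.sum_univ_two (fun i => rankOne ℂ (e i) (e i)), e.sum_rankOne_eq_id]
  rfl

lemma smul_rankOne_self_eq (l : ℝ) (hl : 0 ≤ l) (x : H) :
    (l : ℂ) • rankOne ℂ x x =
      (rankOne ℂ ((Real.sqrt l : ℂ) • x) ((Real.sqrt l : ℂ) • x) : H →L[ℂ] H) := by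
  rw [rankOne_smul_smul, Complex.conj_ofReal, ← Complex.ofReal_mul, Real.mul_self_sqrt hl]

/-- With only two eigenvalues, a vanishing one leaves a single term. The vector `ψ` may be zero,
which covers `A = 0`. -/
lemma isPosDef_or_eq_rankOne (hH : Module.finrank ℂ H = 2) {A : H →L[ℂ] H} (hA : A.IsPositive) :
    IsPosDef A ∨ ∃ ψ : H, A = rankOne ℂ ψ ψ := by
  obtain ⟨e, l, hl, rfl⟩ := exists_spectral hH hA
  by_cases h0 : l 0 = 0
  · exact .inr ⟨_, by rw [h0, Complex.ofReal_zero, zero_smul, zero_add,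
      smul_rankOne_self_eq _ (hl 1)]⟩
  by_cases h1 : l 1 = 0
  · exact .inr ⟨_, by rw [h1, Complex.ofReal_zero, zero_smul, add_zero,
      smul_rankOne_self_eq _ (hl 0)]⟩
  left
  refine ⟨min (l 0) (l 1), lt_min ((hl 0).lt_of_ne' h0) ((hl 1).lt_of_ne' h1), ?_⟩
  rw [ContinuousLinearMap.le_def]
  have : (l 0 : ℂ) • rankOne ℂ (e 0) (e 0) + (l 1 : ℂ) • rankOne ℂ (e 1) (e 1) -
      ((min (l 0) (l 1) : ℝ) : ℂ) • (1 : H →L[ℂ] H) =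
      ((l 0 - min (l 0) (l 1) : ℝ) : ℂ) • rankOne ℂ (e 0) (e 0) +
      ((l 1 - min (l 0) (l 1) : ℝ) : ℂ) • rankOne ℂ (e 1) (e 1) := by
    rw [← e.rankOne_add_rankOne_eq_one]
    push_cast
    module
  rw [this]
  refine ContinuousLinearMap.IsPositive.add ?_ ?_
  · exact (isPositive_rankOne_self _).smul_of_nonneg
      (by exact_mod_cast sub_nonneg.2 (min_le_left _ _))
  · exact (isPositive_rankOne_self _).smul_of_nonneg
      (by exact_mod_cast sub_nonneg.2 (min_le_right _ _))

lemma isPosDef_of_injective (hH : Module.finrank ℂ H = 2) {A : H →L[ℂ] H} (hA : A.IsPositive)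
    (h : ∀ x, A x = 0 → x = 0) : IsPosDef A := by
  rcases isPosDef_or_eq_rankOne hH hA with h1 | ⟨ψ, rfl⟩
  · exact h1
  · obtain ⟨x, hx, hxψ⟩ := exists_orthogonal hH ψ
    exact absurd (h x (by simp [hxψ])) hx

lemma IsPosDef.injective {A : H →L[ℂ] H} (hA : IsPosDef A) {x : H} (h : A x = 0) : x = 0 := by
  by_contra hx
  simpa [h] using hA.re_inner_pos hx

lemma IsPosDef.not_isRankOneOperator (hH : Module.finrank ℂ H = 2) {A : H →L[ℂ] H}
    (hA : IsPosDef A) : ¬ IsRankOneOperator A := by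
  intro h
  have := finiteDimensional_of_finrank_eq_two hH
  have h1 : LinearMap.ker (A : H →ₗ[ℂ] H) = ⊥ := by
    rw [LinearMap.ker_eq_bot']
    exact fun x hx => hA.injective hx
  rw [IsRankOneOperator, LinearMap.finrank_range_of_inj (LinearMap.ker_eq_bot.1 h1), hH] at h
  omega

lemma exists_eq_rankOne (hH : Module.finrank ℂ H = 2) {A : H →L[ℂ] H} (hA : A.IsPositive)
    (h : IsRankOneOperator A) : ∃ ψ : H, ψ ≠ 0 ∧ A = rankOne ℂ ψ ψ := by
  rcases isPosDef_or_eq_rankOne hH hA with h1 | ⟨ψ, rfl⟩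
  · exact absurd h (h1.not_isRankOneOperator hH)
  · refine ⟨ψ, ?_, rfl⟩
    rintro rfl
    have h0 : ((rankOne ℂ (0 : H) 0 : H →L[ℂ] H) : H →ₗ[ℂ] H) = 0 := by
      ext x
      simp
    rw [IsRankOneOperator, h0, LinearMap.range_zero, finrank_bot] at h
    omega

/-- Operators dominated by a rank-one operator are multiples of it. -/
lemma exists_smul_of_le_rankOne (hH : Module.finrank ℂ H = 2) {X : H →L[ℂ] H} {ψ : H}
    (hX : X.IsPositive) (h : X ≤ rankOne ℂ ψ ψ) : ∃ μ : ℂ, X = μ • rankOne ℂ ψ ψ := by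
  rcases isPosDef_or_eq_rankOne hH hX with h1 | ⟨χ, rfl⟩
  · exact absurd (h1.mono h) (not_isPosDef_rankOne hH ψ)
  -- For `y ⟂ ψ` the domination reads `0 ≤ -|⟨χ, y⟩|²`.
  · have hχ : χ ∈ Submodule.span ℂ {ψ} := by
      apply mem_span_of_forall_orthogonal
      intro y hy
      have h2 := ((ContinuousLinearMap.le_def _ _).1 h).re_inner_nonneg_right y
      rw [sub_apply, rankOne_apply, rankOne_apply, hy, zero_smul, zero_sub, inner_neg_right,
        inner_smul_right, ← inner_conj_symm, RCLike.conj_mul] at h2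
      rw [← inner_eq_zero_symm, ← norm_eq_zero]
      rw [map_neg, ← RCLike.ofReal_pow, RCLike.ofReal_re] at h2
      nlinarith [norm_nonneg (inner ℂ y χ)]
    obtain ⟨c, rfl⟩ := Submodule.mem_span_singleton.1 hχ
    exact ⟨_, rankOne_smul_smul c c ψ ψ⟩

lemma span_pair_eq_top (hH : Module.finrank ℂ H = 2) {φ₀ φ₁ : H}
    (h : LinearIndependent ℂ ![φ₀, φ₁]) : ∀ x : H, ∃ a b : ℂ, x = a • φ₀ + b • φ₁ := by
  intro x
  have := finiteDimensional_of_finrank_eq_two hH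
  have h1 := h.span_eq_top_of_card_eq_finrank' (by simp [hH])
  have h2 : x ∈ Submodule.span ℂ (Set.range ![φ₀, φ₁]) := h1 ▸ Submodule.mem_top
  rw [Matrix.range_cons, Matrix.range_cons, Matrix.range_empty, Set.union_empty] at h2
  obtain ⟨a, b, hab⟩ := Submodule.mem_span_pair.1 h2
  exact ⟨a, b, hab.symm⟩

lemma exists_orthogonal_inner_ne_zero (hH : Module.finrank ℂ H = 2) {φ₀ φ₁ : H}
    (h : LinearIndependent ℂ ![φ₀, φ₁]) : ∃ x : H, inner ℂ φ₁ x = 0 ∧ inner ℂ φ₀ x ≠ 0 := by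
  obtain ⟨x, hx, hx1⟩ := exists_orthogonal hH φ₁
  refine ⟨x, hx1, fun hx0 => hx ?_⟩
  obtain ⟨a, b, hab⟩ := span_pair_eq_top hH h x
  rw [← inner_self_eq_zero (𝕜 := ℂ)]
  nth_rewrite 1 [hab]
  rw [inner_add_left, inner_smul_left, inner_smul_left, hx0, hx1]
  simp

/-- Evaluation at a vector orthogonal to `φ₁`, and at one orthogonal to `φ₀`, separates the
coefficients. -/
lemma rankOne_coefficients_eq_zero (hH : Module.finrank ℂ H = 2) {φ₀ φ₁ : H}
    (h : LinearIndependent ℂ ![φ₀, φ₁]) {a b c d : ℂ}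
    (h0 : a • rankOne ℂ φ₀ φ₀ + b • rankOne ℂ φ₀ φ₁ + c • rankOne ℂ φ₁ φ₀ +
      d • rankOne ℂ φ₁ φ₁ = (0 : H →L[ℂ] H)) : a = 0 ∧ b = 0 ∧ c = 0 ∧ d = 0 := by
  obtain ⟨x, hx1, hx0⟩ := exists_orthogonal_inner_ne_zero hH h
  obtain ⟨y, hy0, hy1⟩ := exists_orthogonal_inner_ne_zero hH (LinearIndependent.pair_symm_iff.1 h)
  have h1 := congrArg (fun A : H →L[ℂ] H => A x) h0
  have h2 := congrArg (fun A : H →L[ℂ] H => A y) h0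
  simp only [add_apply, smul_apply, rankOne_apply, hx1, hy0, zero_smul, smul_zero, add_zero,
    zero_add, zero_apply, smul_smul] at h1 h2
  have h3 := LinearIndependent.pair_iff.1 h _ _ h1
  have h4 := LinearIndependent.pair_iff.1 h _ _ h2
  simp only [mul_eq_zero, hx0, hy1, or_false] at h3 h4
  exact ⟨h3.1, h4.1, h3.2, h4.2⟩

end FiniteDim
end Operators

/-! ### Rigidity: channels onto rank-one data are unitary conjugations -/

section Rigidity

variable {H : Type*} [NormedAddCommGroup H] [InnerProductSpace ℂ H]

lemma exists_clm_pair (hH : Module.finrank ℂ H = 2) {ψ₀ ψ₁ : H}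
    (h : LinearIndependent ℂ ![ψ₀, ψ₁]) (x y : H) : ∃ T : H →L[ℂ] H, T ψ₀ = x ∧ T ψ₁ = y := by
  have := finiteDimensional_of_finrank_eq_two hH
  let b := basisOfLinearIndependentOfCardEqFinrank h (by simp [hH])
  have hb : ⇑b = ![ψ₀, ψ₁] := coe_basisOfLinearIndependentOfCardEqFinrank _ _
  let T := b.constr ℂ ![x, y]
  have hT : ∀ i, T (b i) = ![x, y] i := fun i => b.constr_basis ℂ _ i
  rw [hb] at hT
  exact ⟨LinearMap.toContinuousLinearMap T, hT 0, hT 1⟩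

lemma linearMap_ext_rankOne (hH : Module.finrank ℂ H = 2) {ψ₀ ψ₁ : H}
    (h : LinearIndependent ℂ ![ψ₀, ψ₁]) {E F : (H →L[ℂ] H) →ₗ[ℂ] (H →L[ℂ] H)}
    (h00 : E (rankOne ℂ ψ₀ ψ₀) = F (rankOne ℂ ψ₀ ψ₀))
    (h01 : E (rankOne ℂ ψ₀ ψ₁) = F (rankOne ℂ ψ₀ ψ₁))
    (h10 : E (rankOne ℂ ψ₁ ψ₀) = F (rankOne ℂ ψ₁ ψ₀))
    (h11 : E (rankOne ℂ ψ₁ ψ₁) = F (rankOne ℂ ψ₁ ψ₁)) (X : H →L[ℂ] H) : E X = F X := by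
  have := finiteDimensional_of_finrank_eq_two hH
  have key : ∀ x y : H, E (rankOne ℂ x y) = F (rankOne ℂ x y) := by
    intro x y
    obtain ⟨a, b, rfl⟩ := span_pair_eq_top hH h x
    obtain ⟨c, d, rfl⟩ := span_pair_eq_top hH h y
    simp only [map_add, add_apply, map_smul, map_smulₛₗ, smul_apply, h00, h01, h10, h11]
  let e : OrthonormalBasis (Fin 2) ℂ H := (stdOrthonormalBasis ℂ H).reindex (finCongr hH)
  have hX : X = rankOne ℂ (X (e 0)) (e 0) + rankOne ℂ (X (e 1)) (e 1) := by
    ext x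
    have h1 := congrArg X (e.sum_repr' x)
    rw [map_sum] at h1
    rw [← h1, Fin.sum_univ_two]
    simp only [map_smul, add_apply, rankOne_apply]
  rw [hX, map_add, map_add, key, key]

/-- Two rank-one operators that add up to the identity of a qubit are orthogonal projections. -/
lemma orthonormal_of_rankOne_add_rankOne_eq_one (hH : Module.finrank ℂ H = 2) {ψ χ : H}
    (h : rankOne ℂ ψ ψ + rankOne ℂ χ χ = (1 : H →L[ℂ] H)) :
    LinearIndependent ℂ ![ψ, χ] ∧ inner ℂ ψ ψ = 1 ∧ inner ℂ χ χ = 1 ∧ inner ℂ ψ χ = 0 := by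
  have hx : ∀ x, inner ℂ ψ x • ψ + inner ℂ χ x • χ = x := fun x =>
    congrArg (fun A : H →L[ℂ] H => A x) h
  have := finiteDimensional_of_finrank_eq_two hH
  have hli : LinearIndependent ℂ ![ψ, χ] := by
    apply linearIndependent_of_top_le_span_of_card_eq_finrank
    · intro x _
      rw [Matrix.range_cons, Matrix.range_cons, Matrix.range_empty, Set.union_empty]
      exact Submodule.mem_span_pair.2 ⟨_, _, hx x⟩
    · simp [hH]
  have h1 := LinearIndependent.pair_iff.1 hli (inner ℂ ψ ψ - 1) (inner ℂ χ ψ) (by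
    rw [sub_smul, one_smul, sub_add_eq_add_sub, hx, sub_self])
  have h2 := LinearIndependent.pair_iff.1 hli (inner ℂ ψ χ) (inner ℂ χ χ - 1) (by
    rw [sub_smul, one_smul, ← add_sub_assoc, hx, sub_self])
  exact ⟨hli, sub_eq_zero.1 h1.1, sub_eq_zero.1 h2.2, h2.1⟩

/-- All summands are non-negative multiples of `φφ*`. This merges the outcomes on one line into a
single rank-one operator. -/
lemma exists_sum_eq_rankOne {I : Type*} {φ : H} (s : Finset I) (A : I → H →L[ℂ] H)
    (h : ∀ i ∈ s, ∃ ψ ∈ Submodule.span ℂ {φ}, A i = rankOne ℂ ψ ψ) :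
    ∃ ψ, ∑ i ∈ s, A i = rankOne ℂ ψ ψ := by
  have : ∃ l : ℝ, 0 ≤ l ∧ ∑ i ∈ s, A i = (l : ℂ) • rankOne ℂ φ φ := by
    choose! ψ hψ hA using h
    choose! c hc using fun i hi => Submodule.mem_span_singleton.1 (hψ i hi)
    refine ⟨∑ i ∈ s, ‖c i‖ ^ 2, by positivity, ?_⟩
    push_cast
    rw [Finset.sum_smul]
    refine Finset.sum_congr rfl fun i hi => ?_
    rw [hA i hi, ← hc i hi, rankOne_smul_smul, RCLike.mul_conj]
    rfl
  obtain ⟨l, hl, h⟩ := this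
  exact ⟨_, h.trans (smul_rankOne_self_eq l hl φ)⟩

variable [CompleteSpace H]

lemma mem_unitary_of_mul_star_self (hH : Module.finrank ℂ H = 2) {U : H →L[ℂ] H}
    (h : U * star U = 1) : U ∈ unitary (H →L[ℂ] H) := by
  have := finiteDimensional_of_finrank_eq_two hH
  refine Unitary.mem_iff.2 ⟨?_, h⟩
  have h1 : (U : H →ₗ[ℂ] H) * ((star U : H →L[ℂ] H) : H →ₗ[ℂ] H) = 1 := by
    ext x
    exact congrArg (fun A : H →L[ℂ] H => A x) h
  rw [mul_eq_one_comm] at h1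
  ext x
  exact congrArg (fun A : H →ₗ[ℂ] H => A x) h1

lemma conj_rankOne (T : H →L[ℂ] H) (x y : H) :
    T * rankOne ℂ x y * star T = rankOne ℂ (T x) (T y) := by
  rw [ContinuousLinearMap.mul_def, ContinuousLinearMap.mul_def, comp_rankOne, rankOne_comp,
    ContinuousLinearMap.star_eq_adjoint, ContinuousLinearMap.adjoint_adjoint]

lemma inner_star_mul_self (B : H →L[ℂ] H) (x y : H) (C : H →L[ℂ] H) :
    inner ℂ x ((star B * C) y) = inner ℂ (B x) (C y) := by
  rw [ContinuousLinearMap.mul_def, ContinuousLinearMap.comp_apply,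
    ContinuousLinearMap.star_eq_adjoint, ContinuousLinearMap.adjoint_inner_right]

/-- Off-diagonal blocks: if a completely positive map sends `ψᵢ ψᵢ*` to `φᵢ φᵢ*`, it sends
`ψ₀ ψ₁*` to a multiple of `φ₀ φ₁*`. -/
lemma exists_map_rankOne_eq (E : CompletelyPositiveMap (H →L[ℂ] H) (H →L[ℂ] H))
    {ψ₀ ψ₁ φ₀ φ₁ : H} (hφ₁ : φ₁ ≠ 0) (h0 : E (rankOne ℂ ψ₀ ψ₀) = rankOne ℂ φ₀ φ₀)
    (h1 : E (rankOne ℂ ψ₁ ψ₁) = rankOne ℂ φ₁ φ₁) :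
    ∃ b : ℂ, E (rankOne ℂ ψ₀ ψ₁) = b • rankOne ℂ φ₀ φ₁ ∧
      E (rankOne ℂ ψ₁ ψ₀) = (starRingEnd ℂ) b • rankOne ℂ φ₁ φ₀ := by
  obtain ⟨B, hB⟩ := exists_gram E ![ψ₀, ψ₁]
  -- At `x ⟂ f` the quadratic form of the sum is `∑ ‖B k i x‖² = 0`, so every `B k i` kills `f^⊥`.
  -- The off-diagonal block `∑ (B k 0)* (B k 1)` therefore kills `φ₁^⊥` and has range in the line of
  -- `φ₀`.
  have kernel : ∀ (i : Fin 2) (f : H), (∑ k, star (B k i) * B k i) = rankOne ℂ f f →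
      ∀ x, inner ℂ f x = 0 → ∀ k, B k i x = 0 := by
    intro i f hf x hx k
    have h2 := congrArg (fun A : H →L[ℂ] H => (inner ℂ x (A x)).re) hf
    simp only [sum_apply, inner_sum, inner_star_mul_self, rankOne_apply, hx,
      zero_smul, inner_zero_right, inner_self_eq_norm_sq_to_K, Complex.re_sum, Complex.zero_re,
      ← RCLike.ofReal_pow] at h2
    have h3 := (Finset.sum_eq_zero_iff_of_nonneg (f := fun k => ‖B k i x‖ ^ 2)
      (fun k _ => by positivity)).1 h2 k (Finset.mem_univ k)
    simpa using h3
  have k0 := kernel 0 φ₀ ((hB 0 0).symm.trans h0)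
  have k1 := kernel 1 φ₁ ((hB 1 1).symm.trans h1)
  have h01 : E (rankOne ℂ ψ₀ ψ₁) = ∑ k, star (B k 0) * B k 1 := hB 0 1
  have h10 : E (rankOne ℂ ψ₁ ψ₀) = ∑ k, star (B k 1) * B k 0 := hB 1 0
  obtain ⟨b, hb⟩ := exists_eq_smul_rankOne (A := E (rankOne ℂ ψ₀ ψ₁)) (f := φ₀) (g := φ₁)
    (fun x y hx => by
      rw [h01]
      simp only [sum_apply, inner_sum, inner_star_mul_self, k0 x hx, inner_zero_left,
        Finset.sum_const_zero])
    (fun y hy => by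
      rw [h01]
      simp [k1 y hy]) hφ₁
  refine ⟨b, hb, ?_⟩
  have h2 : E (rankOne ℂ ψ₁ ψ₀) = star (E (rankOne ℂ ψ₀ ψ₁)) := by
    rw [h01, h10, star_sum]
    simp
  rw [h2, hb, star_smul, ContinuousLinearMap.star_eq_adjoint, adjoint_rankOne]
  rfl

lemma norm_eq_of_mul_conj_eq {x y : ℂ} (h : x * (starRingEnd ℂ) x = y * (starRingEnd ℂ) y) :
    ‖x‖ = ‖y‖ := by
  rw [RCLike.mul_conj, RCLike.mul_conj] at h
  have h1 : ‖x‖ ^ 2 = ‖y‖ ^ 2 := by exact_mod_cast h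
  exact (sq_eq_sq₀ (norm_nonneg _) (norm_nonneg _)).1 h1

/-- A channel mapping three rank-one operators to pairwise non-collinear rank-one operators is
a unitary conjugation. -/
theorem QChannel.exists_unitary (hH : Module.finrank ℂ H = 2) (E : QChannel H)
    {ψ₀ ψ₁ ψ₂ φ₀ φ₁ φ₂ : H} (h01 : LinearIndependent ℂ ![φ₀, φ₁])
    (h02 : LinearIndependent ℂ ![φ₀, φ₂]) (h12 : LinearIndependent ℂ ![φ₁, φ₂])
    (hE0 : E.toMap (rankOne ℂ ψ₀ ψ₀) = rankOne ℂ φ₀ φ₀)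
    (hE1 : E.toMap (rankOne ℂ ψ₁ ψ₁) = rankOne ℂ φ₁ φ₁)
    (hE2 : E.toMap (rankOne ℂ ψ₂ ψ₂) = rankOne ℂ φ₂ φ₂) :
    ∃ U ∈ unitary (H →L[ℂ] H), ∀ X, E.toMap X = U * X * star U := by
  have hφ0 : φ₀ ≠ 0 := h01.ne_zero 0
  have hφ1 : φ₁ ≠ 0 := h01.ne_zero 1
  have hψ0 : ψ₀ ≠ 0 := by
    rintro rfl
    rw [map_zero, map_zero, eq_comm, rankOne_eq_zero] at hE0
    exact hφ0 (hE0.elim id id)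
  -- If `ψ₁` were a multiple of `ψ₀`, linearity of `E` would make `φ₁φ₁*` a multiple of `φ₀φ₀*`.
  have hψ : LinearIndependent ℂ ![ψ₀, ψ₁] := by
    rw [LinearIndependent.pair_iff' hψ0]
    rintro a rfl
    rw [rankOne_smul_smul, map_smul, hE0] at hE1
    have := (rankOne_coefficients_eq_zero hH h01 (a := a * (starRingEnd ℂ) a) (b := 0) (c := 0)
      (d := -1) (by rw [hE1]; simp)).2.2.2
    norm_num at this
  obtain ⟨b, hb01, hb10⟩ := exists_map_rankOne_eq E.toMap hφ1 hE0 hE1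
  obtain ⟨u, v, rfl⟩ := span_pair_eq_top hH hψ ψ₂
  obtain ⟨x, y, rfl⟩ := span_pair_eq_top hH h01 φ₂
  have hx : x ≠ 0 := by
    rintro rfl
    rw [zero_smul, zero_add, LinearIndependent.pair_iff' hφ1] at h12
    exact h12 y rfl
  have hy : y ≠ 0 := by
    rintro rfl
    rw [zero_smul, add_zero, LinearIndependent.pair_iff' hφ0] at h02
    exact h02 x rfl
  -- Comparing coefficients of `φᵢφⱼ*` in the image of `ψ₂ψ₂*` gives `|u| = |x|`, `|v| = |y|` and `u
  -- v̄ b = x ȳ`, which determines `b`.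
  obtain ⟨c1, c2, -, c4⟩ := rankOne_coefficients_eq_zero hH h01
    (a := u * (starRingEnd ℂ) u - x * (starRingEnd ℂ) x)
    (b := u * (starRingEnd ℂ) v * b - x * (starRingEnd ℂ) y)
    (c := v * (starRingEnd ℂ) u * (starRingEnd ℂ) b - y * (starRingEnd ℂ) x)
    (d := v * (starRingEnd ℂ) v - y * (starRingEnd ℂ) y) (by
      simp only [map_add, add_apply, map_smul, map_smulₛₗ, smul_apply, hE0, hE1, hb01, hb10] at hE2
      rw [← sub_eq_zero] at hE2
      rw [← hE2]
      module)
  rw [sub_eq_zero] at c1 c2 c4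
  have hu : u ≠ 0 := by
    rw [← norm_ne_zero_iff, norm_eq_of_mul_conj_eq c1, norm_ne_zero_iff]
    exact hx
  have hv : v ≠ 0 := by
    rw [← norm_ne_zero_iff, norm_eq_of_mul_conj_eq c4, norm_ne_zero_iff]
    exact hy
  have hu' : (starRingEnd ℂ) u ≠ 0 := by simpa using hu
  have hv' : (starRingEnd ℂ) v ≠ 0 := by simpa using hv
  -- The factors `x / u` and `y / v` are phases, chosen so that `T` sends `u ψ₀ + v ψ₁` to `x φ₀ + y
  -- φ₁`.
  obtain ⟨T, hT0, hT1⟩ := exists_clm_pair hH hψ ((x / u) • φ₀) ((y / v) • φ₁)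
  have hb : b = (x / u) * (starRingEnd ℂ) (y / v) := by
    rw [map_div₀, div_mul_div_comm, ← c2]
    field_simp
  have hET : ∀ X, E.toMap X = T * X * star T := by
    refine linearMap_ext_rankOne hH hψ (E := E.toMap.toLinearMap) (F := (conjCP T).toLinearMap)
      ?_ ?_ ?_ ?_
    · change E.toMap _ = T * _ * star T
      rw [conj_rankOne, hE0, hT0, rankOne_smul_smul, map_div₀, div_mul_div_comm, ← c1,
        div_self (mul_ne_zero hu hu'), one_smul]
    · change E.toMap _ = T * _ * star T
      rw [conj_rankOne, hb01, hT0, hT1, rankOne_smul_smul, hb]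
    · change E.toMap _ = T * _ * star T
      rw [conj_rankOne, hb10, hT0, hT1, rankOne_smul_smul, hb, map_mul, Complex.conj_conj,
        mul_comm]
    · change E.toMap _ = T * _ * star T
      rw [conj_rankOne, hE1, hT1, rankOne_smul_smul, map_div₀, div_mul_div_comm, ← c4,
        div_self (mul_ne_zero hv hv'), one_smul]
  refine ⟨T, mem_unitary_of_mul_star_self hH ?_, hET⟩
  rw [← E.map_one, hET 1, mul_one]

lemma QChannel.exists_eq_rankOne (hH : Module.finrank ℂ H = 2) (E : QChannel H) {X : H →L[ℂ] H}
    {φ : H} (hX : X.IsPositive) (h : E.toMap X = rankOne ℂ φ φ) : ∃ ψ : H, X = rankOne ℂ ψ ψ := by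
  rcases isPosDef_or_eq_rankOne hH hX with h1 | h1
  · exact absurd (h ▸ h1.cp E) (not_isPosDef_rankOne hH φ)
  · exact h1

variable {I : Type*} [Fintype I]

lemma POVM.isNonCollinearTriple_iff (hH : Module.finrank ℂ H = 2) (P : POVM H I)
    (t : Fin 3 → I) : P.IsNonCollinearTriple t ↔
      ∃ φ : Fin 3 → H, (∀ a, P.elem (t a) = rankOne ℂ (φ a) (φ a)) ∧
        ∀ a b, a ≠ b → LinearIndependent ℂ ![φ a, φ b] := by
  constructor
  · rintro ⟨h1, h2⟩
    choose φ hφ0 hφ using fun a => _root_.exists_eq_rankOne hH (P.isPositive (t a)) (h1 a)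
    refine ⟨φ, hφ, fun a b hab => ?_⟩
    have := h2 a b hab
    rwa [hφ, hφ, operatorSupport_rankOne, operatorSupport_rankOne,
      nonCollinear_span_singleton (hφ0 a) (hφ0 b)] at this
  · rintro ⟨φ, hφ, h⟩
    have hφ0 : ∀ a, φ a ≠ 0 := by
      intro a
      obtain ⟨b, hb⟩ := exists_ne a
      exact (h a b hb.symm).ne_zero 0
    refine ⟨fun a => hφ a ▸ isRankOneOperator_rankOne (hφ0 a), fun a b hab => ?_⟩
    rw [hφ, hφ, operatorSupport_rankOne, operatorSupport_rankOne,
      nonCollinear_span_singleton (hφ0 a) (hφ0 b)]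
    exact h a b hab

lemma linearIndependent_finset_pair {V ι : Type*} [AddCommGroup V] [Module ℂ V] [DecidableEq ι]
    (v : ι → V) {a b : ι} (hab : a ≠ b) :
    LinearIndependent ℂ (fun x : ({a, b} : Finset ι) => v x) ↔
      LinearIndependent ℂ ![v a, v b] := by
  let f : Fin 2 ≃ ({a, b} : Finset ι) := Equiv.ofBijective
    ![⟨a, by simp⟩, ⟨b, by simp⟩] (by
      constructor
      · intro i j
        fin_cases i <;> fin_cases j <;> simp [hab, hab.symm]
      · rintro ⟨x, hx⟩
        rcases Finset.mem_insert.1 hx with rfl | hx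
        · exact ⟨0, rfl⟩
        · obtain rfl := Finset.mem_singleton.1 hx
          exact ⟨1, rfl⟩)
  rw [← linearIndependent_equiv f]
  have : (fun x : ({a, b} : Finset ι) => v x) ∘ f = ![v a, v b] := by
    ext i
    fin_cases i <;> rfl
  rw [this]

/-- On a qubit, pairwise non-collinear rank-one triples are the projective frames. -/
theorem POVM.isNonCollinearTriple_iff_isFrameTriple (hH : Module.finrank ℂ H = 2) (P : POVM H I)
    (t : Fin 3 → I) : P.IsNonCollinearTriple t ↔ P.IsFrameTriple t := by
  have := finiteDimensional_of_finrank_eq_two hH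
  constructor
  · intro h
    obtain ⟨φ, hφ, hli⟩ := (P.isNonCollinearTriple_iff hH t).1 h
    refine ⟨h.1, φ, fun a => by rw [hφ, operatorSupport_rankOne], by simp [hH], fun s hs => ?_⟩
    rw [hH] at hs
    obtain ⟨a, b, hab, rfl⟩ := Finset.card_eq_two.1 hs
    have h1 := (linearIndependent_finset_pair φ hab).2 (hli a b hab)
    refine ⟨h1, ?_⟩
    have h2 := h1.span_eq_top_of_card_eq_finrank' (by rw [Fintype.card_coe, hs, hH])
    rw [← h2, Set.image_eq_range]
    rfl
  · rintro ⟨h1, v, hv, -, h2⟩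
    have hli : ∀ a b, a ≠ b → LinearIndependent ℂ ![v a, v b] := fun a b hab =>
      (linearIndependent_finset_pair v hab).1 (h2 {a, b} (by rw [Finset.card_pair hab, hH])).1
    refine ⟨h1, fun a b hab => ?_⟩
    have h3 := hli a b hab
    rw [hv, hv]
    exact (nonCollinear_span_singleton (h3.ne_zero 0) (h3.ne_zero 1)).2 h3

lemma POVM.IsNonCollinearTriple.unitarilyEquivalent (hH : Module.finrank ℂ H = 2) {P Q : POVM H I}
    {t : Fin 3 → I} (ht : P.IsNonCollinearTriple t) (h : Q.IsCleaner P) :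
    Q.UnitarilyEquivalent P := by
  obtain ⟨φ, hφ, hli⟩ := (P.isNonCollinearTriple_iff hH t).1 ht
  obtain ⟨E, hE⟩ := h
  choose ψ hψ using fun a => E.exists_eq_rankOne hH (Q.isPositive (t a)) ((hE (t a)).trans (hφ a))
  have key : ∀ a, E.toMap (rankOne ℂ (ψ a) (ψ a)) = rankOne ℂ (φ a) (φ a) := fun a => by
    rw [← hψ, hE, hφ]
  obtain ⟨U, hU, hEU⟩ := E.exists_unitary hH (hli 0 1 (by decide)) (hli 0 2 (by decide))
    (hli 1 2 (by decide)) (key 0) (key 1) (key 2)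
  exact ⟨U, hU, fun i => by rw [← hEU, hE]⟩

/-- Without a non-collinear triple, the rank-one elements of a POVM lie on two lines, that are
orthogonal unless both occur. -/
lemma POVM.exists_two_lines (hH : Module.finrank ℂ H = 2) (P : POVM H I)
    (ht : ¬ ∃ t : Fin 3 → I, P.IsNonCollinearTriple t) :
    ∃ φ₀ φ₁ : H, LinearIndependent ℂ ![φ₀, φ₁] ∧
      (∀ i ψ, P.elem i = rankOne ℂ ψ ψ →
        ψ ∈ Submodule.span ℂ {φ₀} ∨ ψ ∈ Submodule.span ℂ {φ₁}) ∧
      (inner ℂ φ₀ φ₁ = 0 ∨ ∃ i j, P.elem i = rankOne ℂ φ₀ φ₀ ∧ P.elem j = rankOne ℂ φ₁ φ₁) := by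
  by_cases h : ∃ i j φ₀ φ₁, P.elem i = rankOne ℂ φ₀ φ₀ ∧ P.elem j = rankOne ℂ φ₁ φ₁ ∧
      LinearIndependent ℂ ![φ₀, φ₁]
  · obtain ⟨i, j, φ₀, φ₁, hi, hj, hli⟩ := h
    refine ⟨φ₀, φ₁, hli, fun k ψ hk => ?_, .inr ⟨i, j, hi, hj⟩⟩
    by_contra! hψ
    have h0 : LinearIndependent ℂ ![φ₀, ψ] := by
      refine (LinearIndependent.pair_iff' (hli.ne_zero 0)).2 ?_
      exact fun a ha => hψ.1 (Submodule.mem_span_singleton.2 ⟨a, ha⟩)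
    have h1 : LinearIndependent ℂ ![φ₁, ψ] := by
      refine (LinearIndependent.pair_iff' (hli.ne_zero 1)).2 ?_
      exact fun a ha => hψ.2 (Submodule.mem_span_singleton.2 ⟨a, ha⟩)
    refine ht ⟨![i, j, k], (P.isNonCollinearTriple_iff hH _).2 ⟨![φ₀, φ₁, ψ], ?_, ?_⟩⟩
    · intro a
      fin_cases a
      exacts [hi, hj, hk]
    · intro a b hab
      fin_cases a <;> fin_cases b
      exacts [absurd rfl hab, hli, h0, LinearIndependent.pair_symm_iff.1 hli, absurd rfl hab, h1,
        LinearIndependent.pair_symm_iff.1 h0, LinearIndependent.pair_symm_iff.1 h1,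
        absurd rfl hab]
  · obtain ⟨φ₀, hφ₀, hφ⟩ : ∃ φ₀ : H, φ₀ ≠ 0 ∧ ∀ i ψ, P.elem i = rankOne ℂ ψ ψ →
        ψ ∈ Submodule.span ℂ {φ₀} := by
      by_cases h2 : ∃ i φ₀, φ₀ ≠ 0 ∧ P.elem i = rankOne ℂ φ₀ φ₀
      · obtain ⟨i, φ₀, h0, hi⟩ := h2
        refine ⟨φ₀, h0, fun j ψ hj => ?_⟩
        by_contra hψ
        refine h ⟨i, j, φ₀, ψ, hi, hj, ?_⟩
        rw [LinearIndependent.pair_iff' h0]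
        exact fun a ha => hψ (Submodule.mem_span_singleton.2 ⟨a, ha⟩)
      -- If no non-zero rank-one element occurs, any line will do.
      · obtain ⟨x, hx, -⟩ := exists_orthogonal hH (0 : H)
        refine ⟨x, hx, fun i ψ hi => ?_⟩
        have : ψ = 0 := by
          by_contra h0
          exact h2 ⟨i, ψ, h0, hi⟩
        rw [this]
        exact Submodule.zero_mem _
    obtain ⟨φ₁, hφ₁, h01⟩ := exists_orthogonal hH φ₀
    refine ⟨φ₀, φ₁, ?_, fun i ψ hi => .inl (hφ i ψ hi), .inl h01⟩
    rw [LinearIndependent.pair_iff' hφ₀]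
    rintro a rfl
    rw [inner_smul_right, mul_eq_zero] at h01
    rcases h01 with rfl | h01
    · exact hφ₁ (zero_smul _ _)
    · exact hφ₀ (inner_self_eq_zero.1 h01)

/-- Without a triple, the sums over the two lines are `aa*` and `bb*`, and the corresponding sums of
`Q` are some `cc*` and `dd*`. Each pair adds up to 1, hence is an orthonormal basis, and `U` carries
`c, d` to `a, b`. Every `Q i` lies below `cc*` or `dd*`, so it is a multiple of it, where the
channel and conjugation by `U` agree. -/
lemma POVM.IsRankOne.unitarilyEquivalent (hH : Module.finrank ℂ H = 2) {P Q : POVM H I}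
    (hP : P.IsRankOne) (h : Q.IsCleaner P) : Q.UnitarilyEquivalent P := by
  by_cases ht : ∃ t : Fin 3 → I, P.IsNonCollinearTriple t
  · obtain ⟨t, ht⟩ := ht
    exact ht.unitarilyEquivalent hH h
  classical
  obtain ⟨E, hE⟩ := h
  obtain ⟨φ₀, φ₁, -, hφ, -⟩ := P.exists_two_lines hH ht
  have hex : ∀ i, ∃ ψ, P.elem i = rankOne ℂ ψ ψ := by
    intro i
    by_cases h0 : P.elem i = 0
    · exact ⟨0, by simp [h0]⟩
    · obtain ⟨ψ, -, h1⟩ := _root_.exists_eq_rankOne hH (P.isPositive i) (hP i h0)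
      exact ⟨ψ, h1⟩
  choose ψ hψ using hex
  let s : Finset I := Finset.univ.filter fun i => ψ i ∈ Submodule.span ℂ {φ₀}
  obtain ⟨a, ha⟩ := exists_sum_eq_rankOne (φ := φ₀) s P.elem fun i hi =>
    ⟨ψ i, (Finset.mem_filter.1 hi).2, hψ i⟩
  obtain ⟨b, hb⟩ := exists_sum_eq_rankOne (φ := φ₁) sᶜ P.elem fun i hi =>
    ⟨ψ i, (hφ i _ (hψ i)).resolve_left (fun h => by simp [s, h] at hi), hψ i⟩
  have hQpos : ∀ s : Finset I, (∑ i ∈ s, Q.elem i).IsPositive := fun s =>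
    ContinuousLinearMap.isPositive_sum _ fun i _ => Q.isPositive i
  have hEs : ∀ s : Finset I, E.toMap (∑ i ∈ s, Q.elem i) = ∑ i ∈ s, P.elem i := fun s => by
    rw [map_sum]
    exact Finset.sum_congr rfl fun i _ => hE i
  obtain ⟨c, hc⟩ := E.exists_eq_rankOne hH (hQpos s) ((hEs s).trans ha)
  obtain ⟨d, hd⟩ := E.exists_eq_rankOne hH (hQpos sᶜ) ((hEs sᶜ).trans hb)
  have hab : rankOne ℂ a a + rankOne ℂ b b = (1 : H →L[ℂ] H) := by
    rw [← ha, ← hb, Finset.sum_add_sum_compl, P.sum_eq_one]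
  have hcd : rankOne ℂ c c + rankOne ℂ d d = (1 : H →L[ℂ] H) := by
    rw [← hc, ← hd, Finset.sum_add_sum_compl, Q.sum_eq_one]
  obtain ⟨hcli, -⟩ := orthonormal_of_rankOne_add_rankOne_eq_one hH hcd
  obtain ⟨U, hUc, hUd⟩ := exists_clm_pair hH hcli a b
  have hU : U ∈ unitary (H →L[ℂ] H) := by
    apply mem_unitary_of_mul_star_self hH
    rw [← hab, ← hUc, ← hUd, ← conj_rankOne, ← conj_rankOne, ← add_mul, ← mul_add, hcd, mul_one]
  have key : ∀ (s : Finset I) (x y : H), ∑ i ∈ s, Q.elem i = rankOne ℂ x x →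
      ∑ i ∈ s, P.elem i = rankOne ℂ y y → U x = y →
      ∀ i ∈ s, U * Q.elem i * star U = P.elem i := by
    intro s x y hx hy hxy i hi
    have hle : Q.elem i ≤ rankOne ℂ x x := by
      rw [← hx]
      exact Finset.single_le_sum (f := Q.elem) (fun j _ =>
        (ContinuousLinearMap.nonneg_iff_isPositive _).2 (Q.isPositive j)) hi
    obtain ⟨μ, hμ⟩ := exists_smul_of_le_rankOne hH (Q.isPositive i) hle
    rw [← hE i, hμ, map_smul, ← hx, hEs s, hx, hy, mul_smul_comm, smul_mul_assoc, conj_rankOne, hxy]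
  refine ⟨U, hU, fun i => ?_⟩
  by_cases hi : i ∈ s
  · exact key s c a hc ha hUc i hi
  · exact key sᶜ d b hd hb hUd i (Finset.mem_compl.2 hi)

end Rigidity

/-! ### Clean POVMs: necessity of the criterion -/

section Clean

variable {H : Type*} [NormedAddCommGroup H] [InnerProductSpace ℂ H] [CompleteSpace H]
  {I : Type*} [Fintype I]

/-- Supplies the invertible `S` with which a family of sum `N` is normalized to sum 1. -/
lemma exists_isUnit_gram (hH : Module.finrank ℂ H = 2) {N : H →L[ℂ] H} (hN : IsPosDef N) :
    ∃ S R : H →L[ℂ] H, N = star S * S ∧ S * R = 1 ∧ R * S = 1 := by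
  have := finiteDimensional_of_finrank_eq_two hH
  obtain ⟨S, rfl⟩ := (CStarAlgebra.nonneg_iff_exists_star_mul_self N).1 hN.nonneg
  have hinj : Function.Injective (S : H →ₗ[ℂ] H) := by
    refine LinearMap.ker_eq_bot.1 (LinearMap.ker_eq_bot'.2 fun x hx => hN.injective ?_)
    have hx' : S x = 0 := hx
    rw [ContinuousLinearMap.mul_def, ContinuousLinearMap.comp_apply, hx', map_zero]
  let e := LinearEquiv.ofInjectiveEndo _ hinj
  refine ⟨S, LinearMap.toContinuousLinearMap (e.symm : H →ₗ[ℂ] H), rfl, ?_, ?_⟩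
  · ext x
    exact e.apply_symm_apply x
  · ext x
    exact e.symm_apply_apply x

/-- For a clean POVM `P`: if `P` is obtained from a POVM-like family `q`, with positive definite
sum, by a completely positive map with two Kraus operators, then `q` is positive definite
wherever `P` is. -/
lemma POVM.IsClean.isPosDef_of_kraus (hH : Module.finrank ℂ H = 2) {P : POVM H I}
    (hP : P.IsClean) {q : I → H →L[ℂ] H} (hq : ∀ i, (q i).IsPositive)
    (hN : IsPosDef (∑ i, q i)) {A B : H →L[ℂ] H}
    (hE : ∀ i, A * q i * star A + B * q i * star B = P.elem i) {i : I}
    (hi : IsPosDef (P.elem i)) : IsPosDef (q i) := by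
  obtain ⟨S, R, hS, hSR, hRS⟩ := exists_isUnit_gram hH hN
  have hRS' : star S * star R = 1 := by rw [← star_mul, hRS, star_one]
  have hSR' : star R * star S = 1 := by rw [← star_mul, hSR, star_one]
  -- Normalization by `R = S⁻¹`. The Kraus operators `A S*` and `B S*` undo it, and they form a
  -- channel because the images of the `q i` add up to 1.
  let Q : POVM H I :=
    { elem := fun i => star R * q i * R
      isPositive := fun i => by
        rw [← ContinuousLinearMap.nonneg_iff_isPositive]
        exact star_left_conjugate_nonneg ((ContinuousLinearMap.nonneg_iff_isPositive _).2 (hq i)) R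
      sum_eq_one := by
        rw [← Finset.sum_mul, ← Finset.mul_sum, hS]
        calc star R * (star S * S) * R = (star R * star S) * (S * R) := by simp only [mul_assoc]
          _ = 1 := by rw [hSR, hSR', one_mul] }
  have hconj : ∀ (A X : H →L[ℂ] H),
      A * star S * (star R * X * R) * star (A * star S) = A * X * star A := by
    intro A X
    calc A * star S * (star R * X * R) * star (A * star S)
        = A * (star S * star R) * X * (R * S) * star A := by
          rw [star_mul, star_star]; simp only [mul_assoc]
      _ = A * X * star A := by rw [hRS, hRS', mul_one, mul_one]
  have hone : A * star S * star (A * star S) + B * star S * star (B * star S) = 1 := by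
    have h1 : ∀ A : H →L[ℂ] H, A * star S * star (A * star S) = A * (∑ i, q i) * star A := by
      intro A
      rw [hS, star_mul, star_star]
      simp only [mul_assoc]
    rw [h1, h1, Finset.mul_sum, Finset.mul_sum, Finset.sum_mul, Finset.sum_mul,
      ← Finset.sum_add_distrib, ← P.sum_eq_one]
    exact Finset.sum_congr rfl fun i _ => hE i
  have hQP : Q.IsCleaner P := by
    refine ⟨twoKrausChannel _ _ hone, fun i => ?_⟩
    rw [twoKrausChannel_apply, ← hE i]
    congr 1
    · exact hconj A (q i)
    · exact hconj B (q i)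
  obtain ⟨F, hF⟩ := hP Q hQP
  have hQi : IsPosDef (star R * q i * R) := by
    have h := hi.cp F
    rwa [hF i] at h
  rcases isPosDef_or_eq_rankOne hH (hq i) with h | ⟨ψ, hψ⟩
  · exact h
  · have h2 := conj_rankOne (star R) ψ ψ
    rw [star_star, ← hψ] at h2
    exact absurd (h2 ▸ hQi) (not_isPosDef_rankOne hH _)

lemma conj_isPositive {X : H →L[ℂ] H} (hX : X.IsPositive) (Z : H →L[ℂ] H) :
    (Z * X * star Z).IsPositive := by
  rw [← ContinuousLinearMap.nonneg_iff_isPositive] at hX ⊢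
  exact star_right_conjugate_nonneg hX Z

lemma sqrt_smul_conj {l : ℝ} (hl : 0 ≤ l) (A X : H →L[ℂ] H) :
    ((Real.sqrt l : ℂ) • A) * X * star ((Real.sqrt l : ℂ) • A) = (l : ℂ) • (A * X * star A) := by
  rw [star_smul, smul_mul_assoc, smul_mul_assoc, mul_smul_comm, smul_smul]
  congr 1
  rw [RCLike.star_def, Complex.conj_ofReal, ← Complex.ofReal_mul, Real.mul_self_sqrt hl]

/-- Amplifying the part of a clean POVM that is odd under an involution `Z` until some element
becomes singular: there is no such odd part. -/
lemma POVM.IsClean.conj_eq_self (hH : Module.finrank ℂ H = 2) {P : POVM H I}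
    (hP : P.IsClean) {Z : H →L[ℂ] H} (hZ : Z * Z = 1)
    (hZP : ∀ i, IsPosDef (P.elem i) ∨ Z * P.elem i * star Z = P.elem i)
    (hN : ∀ t : ℝ, 0 ≤ t →
      (∀ i, (P.elem i + (t : ℂ) • (P.elem i - Z * P.elem i * star Z)).IsPositive) →
      IsPosDef (∑ i, (P.elem i + (t : ℂ) • (P.elem i - Z * P.elem i * star Z)))) (i : I) :
    Z * P.elem i * star Z = P.elem i := by
  set D : I → H →L[ℂ] H := fun i => P.elem i - Z * P.elem i * star Z with hD
  have hsZ : star Z * star Z = 1 := by rw [← star_mul, hZ, star_one]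
  have hZZ : ∀ X, Z * (Z * X * star Z) * star Z = X := fun X => by
    calc Z * (Z * X * star Z) * star Z = (Z * Z) * X * (star Z * star Z) := by
          simp only [mul_assoc]
      _ = X := by rw [hZ, hsZ, one_mul, mul_one]
  have hPs : ∀ i, (P.elem i).IsSymmetric := fun i => (P.isPositive i).isSymmetric
  have hDs : ∀ i, (D i).IsSymmetric := fun i => by
    simpa [hD] using (hPs i).sub (conj_isPositive (P.isPositive i) Z).isSymmetric
  have hZq : ∀ i (t : ℂ), Z * (P.elem i + t • D i) * star Z = P.elem i + (-(1 + t)) • D i := by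
    intro i t
    have h1 : Z * D i * star Z = - D i := by
      simp only [hD]
      rw [mul_sub, sub_mul, hZZ]
      abel
    have h2 : Z * P.elem i * star Z = P.elem i - D i := by simp [hD]
    rw [mul_add, add_mul, mul_smul_comm, smul_mul_assoc, h1, h2]
    module
  -- The amplifications `t` that keep every `P i + t D i` non-negative.
  let T : Set ℝ := {t | 0 ≤ t ∧ ∀ i x, 0 ≤ (inner ℂ (P.elem i x) x).re + t * (inner ℂ (D i x) x).re}
  have hT : ∀ {t : ℝ}, t ∈ T → ∀ i, (P.elem i + (t : ℂ) • D i).IsPositive := fun ht i =>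
    (isPositive_add_smul_iff (hPs i) (hDs i) _).2 (ht.2 i)
  have hT0 : T.Nonempty := ⟨0, le_rfl, fun i x => by
    simpa using (P.isPositive i).re_inner_nonneg_left x⟩
  have hTc : IsClosed T := by
    have : T = {t | 0 ≤ t} ∩ ⋂ i, ⋂ x,
        {t | 0 ≤ (inner ℂ (P.elem i x) x).re + t * (inner ℂ (D i x) x).re} := by
      ext t
      simp [T]
    rw [this]
    refine (isClosed_le continuous_const continuous_id).inter
      (isClosed_iInter fun i => isClosed_iInter fun x => isClosed_le continuous_const ?_)
    fun_prop
  by_contra hi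
  have hDi : D i ≠ 0 := fun h => hi (sub_eq_zero.1 h).symm
  obtain ⟨x, hx⟩ : ∃ x, (inner ℂ (D i x) x).re ≠ 0 := by
    by_contra! h
    apply hDi
    have h1 : ((D i : H →L[ℂ] H) : H →ₗ[ℂ] H) = 0 := by
      rw [← inner_map_self_eq_zero]
      intro x
      have h2 : (starRingEnd ℂ) (inner ℂ (D i x) x) = inner ℂ (D i x) x := by
        rw [inner_conj_symm]
        exact (hDs i x x).symm
      rw [ContinuousLinearMap.coe_coe, ← Complex.conj_eq_iff_re.1 h2, h x, Complex.ofReal_zero]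
    ext x
    exact congrArg (fun A : H →ₗ[ℂ] H => A x) h1
  -- Conjugation by `Z` turns `P i + t D i` into `P i - (1 + t) D i`, so both signs of `D i` are
  -- constrained and `t |⟨D i x, x⟩| ≤ ⟨P i x, x⟩`.
  have hTb : BddAbove T := by
    refine ⟨(inner ℂ (P.elem i x) x).re / |(inner ℂ (D i x) x).re|, fun t ht => ?_⟩
    rw [le_div_iff₀ (abs_pos.2 hx)]
    have h1 := ht.2 i x
    have h2 := (conj_isPositive (hT ht i) Z)
    rw [hZq, show (-(1 + (t : ℂ))) = ((-(1 + t) : ℝ) : ℂ) by push_cast; ring,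
      isPositive_add_smul_iff (hPs i) (hDs i)] at h2
    have h3 := h2 x
    have h4 := ht.1
    rcases abs_cases (inner ℂ (D i x) x).re with ⟨h5, h6⟩ | ⟨h5, h6⟩ <;> rw [h5] <;> nlinarith
  set s := sSup T with hs
  have hsT : s ∈ T := hTc.csSup_mem hT0 hTb
  have h12 : 0 < 1 + 2 * s := by linarith [hsT.1]
  -- The weights for which `α (P + s D) + β (P - (1 + s) D) = P`.
  obtain ⟨α, β, hα, hβ, hαβ, hαβs⟩ : ∃ α β : ℝ, 0 ≤ α ∧ 0 ≤ β ∧ α + β = 1 ∧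
      α * s = β * (1 + s) := by
    refine ⟨(1 + s) / (1 + 2 * s), s / (1 + 2 * s), div_nonneg (by linarith [hsT.1]) h12.le,
      div_nonneg hsT.1 h12.le, ?_, by ring⟩
    rw [← add_div, div_eq_one_iff_eq h12.ne']
    ring
  have hpd : ∀ i, IsPosDef (P.elem i) → IsPosDef (P.elem i + (s : ℂ) • D i) := fun i =>
    hP.isPosDef_of_kraus hH (hT hsT) (hN s hsT.1 (hT hsT))
      (A := (Real.sqrt α : ℂ) • 1) (B := (Real.sqrt β : ℂ) • Z) (fun i => by
        rw [sqrt_smul_conj hα, sqrt_smul_conj hβ, one_mul, star_one, mul_one, hZq]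
        have h1 : (α : ℂ) + β = 1 := by exact_mod_cast hαβ
        have h2 : (α : ℂ) * s = β * (1 + s) := by exact_mod_cast hαβs
        match_scalars
        · linear_combination h1 + h2
        · linear_combination -h2)
  -- At the maximal `s`, cleanness keeps the positive definite elements positive definite and the
  -- others have no odd part, so `s` can still be increased.
  have hev : ∀ᶠ t : ℝ in nhds 0, ∀ i, (P.elem i + ((s + t : ℝ) : ℂ) • D i).IsPositive := by
    rw [Filter.eventually_all]
    intro i
    rcases hZP i with h | h
    · obtain ⟨δ, hδ, h1⟩ := (hpd i h).exists_perturbation (hT hsT i) (hDs i)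
      filter_upwards [Metric.ball_mem_nhds (0 : ℝ) hδ] with t ht
      rw [Metric.mem_ball, dist_zero_right, Real.norm_eq_abs] at ht
      have h2 := h1 t ht
      rw [ContinuousLinearMap.nonneg_iff_isPositive] at h2
      convert h2 using 1
      push_cast
      module
    · have h0 : D i = 0 := by simp only [hD, h, sub_self]
      filter_upwards with t
      rw [h0, smul_zero, add_zero]
      exact P.isPositive i
  obtain ⟨δ, hδ, hδT⟩ := Metric.eventually_nhds_iff.1 hev
  have h1 := hδT (y := δ / 2) (by
    rw [dist_zero_right, Real.norm_eq_abs, abs_of_pos (by linarith)]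
    linarith)
  have h2 : s + δ / 2 ∈ T := ⟨by linarith [hsT.1], fun i =>
    (isPositive_add_smul_iff (hPs i) (hDs i) _).1 (h1 i)⟩
  linarith [le_csSup hTb h2]

/-- A clean POVM commuting with a reflection has no positive definite element. -/
lemma POVM.IsClean.not_isPosDef_of_conj_eq_self [Nontrivial I] (hH : Module.finrank ℂ H = 2)
    {P : POVM H I} (hP : P.IsClean) {Z : H →L[ℂ] H} (hZ : Z * Z = 1)
    (hZP : ∀ i, Z * P.elem i * star Z = P.elem i) {φ₀ φ₁ : H}
    (hφ : LinearIndependent ℂ ![φ₀, φ₁]) (hZ0 : Z φ₀ = φ₀) (hZ1 : Z φ₁ = -φ₁) (i : I) :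
    ¬ IsPosDef (P.elem i) := by
  classical
  intro hi
  -- Summing the invariance over all outcomes makes `Z` unitary, hence self-adjoint, so its two
  -- eigenlines are orthogonal.
  have hZZ : Z * star Z = 1 := by
    calc Z * star Z = ∑ i, Z * P.elem i * star Z := by
          rw [← Finset.sum_mul, ← Finset.mul_sum, P.sum_eq_one, mul_one]
      _ = 1 := by rw [← P.sum_eq_one]; exact Finset.sum_congr rfl fun i _ => hZP i
  have hsZ : star Z = Z := by
    calc star Z = Z * Z * star Z := by rw [hZ, one_mul]
      _ = Z := by rw [mul_assoc, hZZ, mul_one]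
  have hcomm : ∀ i, Z * P.elem i = P.elem i * Z := fun i => by
    have h := congrArg (· * Z) (hZP i)
    simp only [hsZ] at h
    rwa [mul_assoc, hZ, mul_one] at h
  have hZin : ∀ x y, inner ℂ (Z x) y = inner ℂ x (Z y) := fun x y => by
    conv_lhs => rw [← hsZ, ContinuousLinearMap.star_eq_adjoint]
    exact ContinuousLinearMap.adjoint_inner_left _ _ _
  have hφ01 : inner ℂ φ₀ φ₁ = 0 := by
    have h := hZin φ₀ φ₁
    rw [hZ0, hZ1, inner_neg_right] at h
    exact self_eq_neg.1 h
  have hφ0 : φ₀ ≠ 0 := hφ.ne_zero 0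
  have hφ1 : φ₁ ≠ 0 := hφ.ne_zero 1
  obtain ⟨e₀, e₁, he0, he1, he01, hsum, hZe0, hZe1⟩ : ∃ e₀ e₁ : H, inner ℂ e₀ e₀ = 1 ∧
      inner ℂ e₁ e₁ = 1 ∧ inner ℂ e₀ e₁ = 0 ∧
      rankOne ℂ e₀ e₀ + rankOne ℂ e₁ e₁ = (1 : H →L[ℂ] H) ∧ Z e₀ = e₀ ∧ Z e₁ = -e₁ := by
    have hn0 : (‖φ₀‖ : ℂ) ≠ 0 := by simpa using hφ0
    have hn1 : (‖φ₁‖ : ℂ) ≠ 0 := by simpa using hφ1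
    have hi0 : inner ℂ φ₀ φ₀ = (‖φ₀‖ : ℂ) ^ 2 := inner_self_eq_norm_sq_to_K φ₀
    have hi1 : inner ℂ φ₁ φ₁ = (‖φ₁‖ : ℂ) ^ 2 := inner_self_eq_norm_sq_to_K φ₁
    have hφ10 : inner ℂ φ₁ φ₀ = 0 := inner_eq_zero_symm.1 hφ01
    refine ⟨(‖φ₀‖ : ℂ)⁻¹ • φ₀, (‖φ₁‖ : ℂ)⁻¹ • φ₁, ?_, ?_, ?_, ?_, ?_, ?_⟩
    · rw [inner_smul_left, inner_smul_right, hi0, map_inv₀, Complex.conj_ofReal]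
      field_simp
    · rw [inner_smul_left, inner_smul_right, hi1, map_inv₀, Complex.conj_ofReal]
      field_simp
    · rw [inner_smul_left, inner_smul_right, hφ01, mul_zero, mul_zero]
    · ext x
      obtain ⟨a, b, rfl⟩ := span_pair_eq_top hH hφ x
      rw [rankOne_smul_smul, rankOne_smul_smul, map_inv₀, map_inv₀, Complex.conj_ofReal,
        Complex.conj_ofReal]
      simp only [add_apply, smul_apply, rankOne_apply, inner_add_right, inner_smul_right, hi0, hi1,
        hφ01, hφ10, one_apply_eq_self]
      match_scalars <;> field_simp <;> ring
    · rw [map_smul, hZ0]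
    · rw [map_smul, hZ1, smul_neg]
  have he10 : inner ℂ e₁ e₀ = 0 := inner_eq_zero_symm.1 he01
  have hx : ∀ x, x = inner ℂ e₀ x • e₀ + inner ℂ e₁ x • e₁ := fun x =>
    (congrArg (fun A : H →L[ℂ] H => A x) hsum).symm
  have he0' : e₀ ≠ 0 := fun h => by simp [h] at he0
  have he1' : e₁ ≠ 0 := fun h => by simp [h] at he1
  by_cases hP1 : P.elem i = 1
  -- A second outcome is essential here: the one-outcome POVM is clean. The basis measurement
  -- `e₀e₀*`, `e₁e₁*` on `i`, `j` is mapped to `1`, `0` by the Kraus operators `e₀e₀*` and `e₁e₀*`.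
  · obtain ⟨j, hj⟩ := exists_ne i
    have hP0 : ∀ k, k ≠ i → P.elem k = 0 := by
      have h1 : ∑ k ∈ Finset.univ.erase i, P.elem k = 0 := by
        have := Finset.add_sum_erase Finset.univ P.elem (Finset.mem_univ i)
        rwa [P.sum_eq_one, hP1, add_eq_left] at this
      have h2 := (Finset.sum_eq_zero_iff_of_nonneg fun k _ =>
        (ContinuousLinearMap.nonneg_iff_isPositive _).2 (P.isPositive k)).1 h1
      exact fun k hk => h2 k (Finset.mem_erase.2 ⟨hk, Finset.mem_univ k⟩)
    let q : I → H →L[ℂ] H := fun k =>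
      if k = i then rankOne ℂ e₀ e₀ else if k = j then rankOne ℂ e₁ e₁ else 0
    have hqi : q i = rankOne ℂ e₀ e₀ := if_pos rfl
    have hqj : q j = rankOne ℂ e₁ e₁ := by simp [q, hj]
    have hqk : ∀ k, k ≠ i → k ≠ j → q k = 0 := fun k h1 h2 => by simp [q, h1, h2]
    have hqsum : ∑ k, q k = 1 := by
      rw [Fintype.sum_eq_add i j hj.symm fun k hk => hqk k hk.1 hk.2, hqi, hqj, hsum]
    have h := hP.isPosDef_of_kraus hH (q := q) (i := i) (A := rankOne ℂ e₀ e₀)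
      (B := rankOne ℂ e₁ e₀) (fun k => ?_) (hqsum ▸ isPosDef_one) (fun k => ?_) hi
    · rw [hqi] at h
      exact not_isPosDef_rankOne hH _ h
    · by_cases hki : k = i
      · rw [hki, hqi]
        exact isPositive_rankOne_self _
      · by_cases hkj : k = j
        · rw [hkj, hqj]
          exact isPositive_rankOne_self _
        · rw [hqk k hki hkj]
          exact ContinuousLinearMap.isPositive_zero
    · by_cases hki : k = i
      · rw [hki, hqi, hP1, conj_rankOne, conj_rankOne, rankOne_apply, rankOne_apply, he0, one_smul,
          one_smul, hsum]
      · rw [hP0 k hki]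
        by_cases hkj : k = j
        · rw [hkj, hqj, conj_rankOne, conj_rankOne, rankOne_apply, rankOne_apply, he01, zero_smul,
            zero_smul]
          simp
        · rw [hqk k hki hkj]
          simp
  · have hdiag : ∃ α β : ℝ, 0 < α ∧ 0 < β ∧
        P.elem i = (α : ℂ) • rankOne ℂ e₀ e₀ + (β : ℂ) • rankOne ℂ e₁ e₁ := by
      have hZPx : ∀ x, Z (P.elem i x) = P.elem i (Z x) := fun x =>
        congrArg (fun A : H →L[ℂ] H => A x) (hcomm i)
      have h10 : inner ℂ e₁ (P.elem i e₀) = 0 := by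
        have h := hZin e₁ (P.elem i e₀)
        rw [hZPx, hZe0, hZe1, inner_neg_left] at h
        exact self_eq_neg.1 h.symm
      have h01 : inner ℂ e₀ (P.elem i e₁) = 0 := by
        have h := hZin e₀ (P.elem i e₁)
        rw [hZPx, hZe0, hZe1, map_neg, inner_neg_right] at h
        exact self_eq_neg.1 h
      have hre : ∀ x, inner ℂ x (P.elem i x) = ((inner ℂ x (P.elem i x)).re : ℂ) := fun x => by
        refine (Complex.conj_eq_iff_re.1 ?_).symm
        rw [inner_conj_symm]
        exact (P.isPositive i).isSymmetric x x
      refine ⟨_, _, hi.re_inner_pos he0', hi.re_inner_pos he1', ?_⟩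
      ext x
      have h0 := hx (P.elem i e₀)
      have h1 := hx (P.elem i e₁)
      rw [h10, zero_smul, add_zero] at h0
      rw [h01, zero_smul, zero_add] at h1
      rw [← hre, ← hre]
      conv_lhs => rw [hx x, map_add, map_smul, map_smul, h0, h1]
      simp only [add_apply, smul_apply, rankOne_apply, smul_comm (inner ℂ e₀ x),
        smul_comm (inner ℂ e₁ x)]
    obtain ⟨α, β, hα, hβ, hPi⟩ := hdiag
    -- `Z` flips the sign of `e₁`, so averaging `ww*` over `1` and `Z` removes the cross terms and
    -- leaves `P i`.
    set w : H := (Real.sqrt α : ℂ) • e₀ + (Real.sqrt β : ℂ) • e₁ with hw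
    have hsα : (Real.sqrt α : ℂ) * Real.sqrt α = α := by
      exact_mod_cast Real.mul_self_sqrt hα.le
    have hsβ : (Real.sqrt β : ℂ) * Real.sqrt β = β := by
      exact_mod_cast Real.mul_self_sqrt hβ.le
    have hqpos : ∀ k, (Function.update P.elem i (rankOne ℂ w w) k).IsPositive := by
      intro k
      rcases eq_or_ne k i with rfl | hk
      · rw [Function.update_self]
        exact isPositive_rankOne_self _
      · rw [Function.update_of_ne hk]
        exact P.isPositive k
    have hn : ∀ e x : H, inner ℂ e x * inner ℂ x e = (‖inner ℂ e x‖ : ℂ) ^ 2 := fun e x => by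
      rw [← inner_conj_symm x]
      exact RCLike.mul_conj _
    have hquad : ∀ x, (inner ℂ x (P.elem i x)).re =
        α * ‖inner ℂ e₀ x‖ ^ 2 + β * ‖inner ℂ e₁ x‖ ^ 2 := by
      intro x
      have h : inner ℂ x (P.elem i x) =
          ((α * ‖inner ℂ e₀ x‖ ^ 2 + β * ‖inner ℂ e₁ x‖ ^ 2 : ℝ) : ℂ) := by
        rw [hPi]
        simp only [add_apply, smul_apply, rankOne_apply, inner_add_right, inner_smul_right, hn]
        push_cast
        rfl
      rw [h, Complex.ofReal_re]
    have hnorm : ∀ x, (inner ℂ x x).re = ‖inner ℂ e₀ x‖ ^ 2 + ‖inner ℂ e₁ x‖ ^ 2 := by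
      intro x
      have h : inner ℂ x x = ((‖inner ℂ e₀ x‖ ^ 2 + ‖inner ℂ e₁ x‖ ^ 2 : ℝ) : ℂ) := by
        have h2 := congrArg (inner ℂ x) (hx x)
        rw [inner_add_right, inner_smul_right, inner_smul_right, hn, hn] at h2
        rw [h2]
        push_cast
        rfl
      rw [h, Complex.ofReal_re]
    have hsumP : ∀ x, ∑ k, (inner ℂ x (P.elem k x)).re = (inner ℂ x x).re := fun x => by
      rw [← Complex.re_sum, ← inner_sum, ← sum_apply, P.sum_eq_one, one_apply_eq_self]
    have hle : ∀ x, (inner ℂ x (P.elem i x)).re ≤ (inner ℂ x x).re := fun x => by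
      rw [← hsumP]
      exact Finset.single_le_sum (f := fun k => (inner ℂ x (P.elem k x)).re)
        (fun k _ => (P.isPositive k).re_inner_nonneg_right x) (Finset.mem_univ i)
    have hα1 : α ≤ 1 := by
      have h := hle e₀
      rw [hquad, hnorm, he0, he10] at h
      simpa using h
    have hβ1 : β ≤ 1 := by
      have h := hle e₁
      rw [hquad, hnorm, he1, he01] at h
      simpa using h
    have hlt : α < 1 ∨ β < 1 := by
      by_contra! h
      apply hP1
      rw [hPi, le_antisymm hα1 h.1, le_antisymm hβ1 h.2, Complex.ofReal_one, one_smul, one_smul,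
        hsum]
    -- A kernel vector `x` is orthogonal to `w` and satisfies `⟨x, P i x⟩ = ⟨x, x⟩`. As `α` or `β`
    -- is below 1, one coordinate of `x` vanishes, and `x ⟂ w` kills the other.
    have hN : IsPosDef (∑ k, Function.update P.elem i (rankOne ℂ w w) k) := by
      refine isPosDef_of_injective hH (ContinuousLinearMap.isPositive_sum _ fun k _ => hqpos k)
        fun x hx0 => ?_
      have h3 : ∑ k, (inner ℂ x (Function.update P.elem i (rankOne ℂ w w) k x)).re = 0 := by
        rw [← Complex.re_sum, ← inner_sum, ← sum_apply, hx0, inner_zero_right, Complex.zero_re]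
      have h4 := (Finset.sum_eq_zero_iff_of_nonneg fun k _ =>
        (hqpos k).re_inner_nonneg_right x).1 h3
      have hwx : inner ℂ w x = 0 := by
        have h6 := h4 i (Finset.mem_univ i)
        rw [Function.update_self, rankOne_apply, inner_smul_right, ← inner_conj_symm x,
          RCLike.mul_conj] at h6
        rw [← norm_eq_zero]
        have h7 : ‖inner ℂ w x‖ ^ 2 = 0 := by exact_mod_cast h6
        simpa using h7
      have h5 : (inner ℂ x x).re = (inner ℂ x (P.elem i x)).re := by
        rw [← hsumP]
        refine Finset.sum_eq_single_of_mem i (Finset.mem_univ i) fun k _ hk => ?_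
        have h6 := h4 k (Finset.mem_univ k)
        rwa [Function.update_of_ne hk] at h6
      rw [hquad, hnorm] at h5
      rw [hw, inner_add_left, inner_smul_left, inner_smul_left, Complex.conj_ofReal,
        Complex.conj_ofReal] at hwx
      have hα0 : (Real.sqrt α : ℂ) ≠ 0 := by
        exact_mod_cast (Real.sqrt_pos.2 hα).ne'
      have hβ0 : (Real.sqrt β : ℂ) ≠ 0 := by
        exact_mod_cast (Real.sqrt_pos.2 hβ).ne'
      have h8 : (1 - α) * ‖inner ℂ e₀ x‖ ^ 2 + (1 - β) * ‖inner ℂ e₁ x‖ ^ 2 = 0 := by linarith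
      have h9 := (add_eq_zero_iff_of_nonneg (mul_nonneg (sub_nonneg.2 hα1) (sq_nonneg _))
        (mul_nonneg (sub_nonneg.2 hβ1) (sq_nonneg _))).1 h8
      have h10 : inner ℂ e₀ x = 0 ∧ inner ℂ e₁ x = 0 := by
        rcases hlt with h | h
        · have h11 : inner ℂ e₀ x = 0 := by
            simpa [(sub_pos.2 h).ne'] using h9.1
          rw [h11, mul_zero, zero_add] at hwx
          exact ⟨h11, (mul_eq_zero.1 hwx).resolve_left hβ0⟩
        · have h11 : inner ℂ e₁ x = 0 := by
            simpa [(sub_pos.2 h).ne'] using h9.2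
          rw [h11, mul_zero, add_zero] at hwx
          exact ⟨(mul_eq_zero.1 hwx).resolve_left hα0, h11⟩
      rw [hx x, h10.1, h10.2, zero_smul, zero_smul, add_zero]
    have h := hP.isPosDef_of_kraus hH hqpos hN (i := i)
      (A := (Real.sqrt (1 / 2) : ℂ) • 1) (B := (Real.sqrt (1 / 2) : ℂ) • Z) (fun k => ?_) hi
    · rw [Function.update_self] at h
      exact not_isPosDef_rankOne hH _ h
    · rw [sqrt_smul_conj (by norm_num), sqrt_smul_conj (by norm_num), one_mul, star_one, mul_one]
      rcases eq_or_ne k i with rfl | hk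
      · rw [Function.update_self, conj_rankOne, hPi, hw]
        simp only [map_add, map_smul, map_smulₛₗ, hZe0, hZe1, add_apply, smul_apply, map_neg,
          neg_apply, Complex.conj_ofReal]
        rw [← hsα, ← hsβ]
        push_cast
        module
      · rw [Function.update_of_ne hk, hZP]
        push_cast
        module

/-- A clean POVM on a qubit is rank-one or has three rank-one elements with pairwise
non-collinear supports. -/
theorem POVM.IsClean.isRankOne_or_exists_triple [Nontrivial I] (hH : Module.finrank ℂ H = 2)
    {P : POVM H I} (hP : P.IsClean) :
    P.IsRankOne ∨ ∃ t : Fin 3 → I, P.IsNonCollinearTriple t := by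
  by_contra! h
  obtain ⟨h1, h2⟩ := h
  rw [POVM.IsRankOne] at h1
  push Not at h1
  obtain ⟨i₀, hi0, hi1⟩ := h1
  have hpd : IsPosDef (P.elem i₀) := by
    rcases isPosDef_or_eq_rankOne hH (P.isPositive i₀) with h | ⟨ψ, hψ⟩
    · exact h
    · rw [hψ] at hi0 hi1
      refine absurd (isRankOneOperator_rankOne fun h0 => ?_) hi1
      simp [h0] at hi0
  obtain ⟨φ₀, φ₁, hli, hφ, horth⟩ := P.exists_two_lines hH (not_exists.2 h2)
  obtain ⟨Z, hZ0, hZ1⟩ := exists_clm_pair hH hli φ₀ (-φ₁)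
  have hZ : Z * Z = 1 := by
    ext x
    obtain ⟨a, b, rfl⟩ := span_pair_eq_top hH hli x
    simp [hZ0, hZ1]
  have hconj : ∀ i ψ, P.elem i = rankOne ℂ ψ ψ → Z * P.elem i * star Z = P.elem i := by
    intro i ψ h
    rw [h, conj_rankOne]
    rcases hφ i ψ h with h | h <;> obtain ⟨c, rfl⟩ := Submodule.mem_span_singleton.1 h
    · rw [map_smul, hZ0]
    · rw [map_smul, hZ1]
      simp
  have hZP : ∀ i, IsPosDef (P.elem i) ∨ Z * P.elem i * star Z = P.elem i := fun i =>
    (isPosDef_or_eq_rankOne hH (P.isPositive i)).imp id fun ⟨ψ, h⟩ => hconj i ψ h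
  refine hP.not_isPosDef_of_conj_eq_self hH hZ ?_ hli hZ0 hZ1 i₀ hpd
  refine hP.conj_eq_self hH hZ hZP fun t ht hq => ?_
  -- The amplified family has positive definite sum. On orthogonal lines `Z` is unitary, so the odd
  -- parts add up to 0; otherwise `φ₀φ₀*` and `φ₁φ₁*` both occur unchanged, and no non-zero vector
  -- is orthogonal to both lines.
  rcases horth with horth | ⟨i, j, hi, hj⟩
  · have hZZ : Z * star Z = 1 := by
      have horth' := inner_eq_zero_symm.1 horth
      have hsZ : star Z = Z := by
        rw [ContinuousLinearMap.star_eq_adjoint, eq_comm, ContinuousLinearMap.eq_adjoint_iff]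
        intro x y
        obtain ⟨a, b, rfl⟩ := span_pair_eq_top hH hli x
        obtain ⟨c, d, rfl⟩ := span_pair_eq_top hH hli y
        simp [hZ0, hZ1, horth, horth', inner_add_left, inner_add_right, inner_smul_left,
          inner_smul_right]
      rw [hsZ, hZ]
    rw [Finset.sum_add_distrib, ← Finset.smul_sum, Finset.sum_sub_distrib, ← Finset.sum_mul,
      ← Finset.mul_sum, P.sum_eq_one, mul_one, hZZ, sub_self, smul_zero, add_zero]
    exact isPosDef_one
  · refine isPosDef_of_injective hH (ContinuousLinearMap.isPositive_sum _ fun k _ => hq k)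
      fun x hx => ?_
    have h3 : ∑ k, (inner ℂ x
        ((P.elem k + (t : ℂ) • (P.elem k - Z * P.elem k * star Z)) x)).re = 0 := by
      rw [← Complex.re_sum, ← inner_sum, ← sum_apply, hx, inner_zero_right, Complex.zero_re]
    have h4 := (Finset.sum_eq_zero_iff_of_nonneg fun k _ =>
      (hq k).re_inner_nonneg_right x).1 h3
    have h5 : ∀ k φ, P.elem k = rankOne ℂ φ φ → inner ℂ φ x = 0 := by
      intro k φ hk
      have h6 := h4 k (Finset.mem_univ k)
      rw [hconj k φ hk, sub_self, smul_zero, add_zero, hk, rankOne_apply, inner_smul_right,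
        ← inner_conj_symm x, RCLike.mul_conj] at h6
      rw [← norm_eq_zero]
      have h7 : ‖inner ℂ φ x‖ ^ 2 = 0 := by exact_mod_cast h6
      simpa using h7
    obtain ⟨a, b, hab⟩ := span_pair_eq_top hH hli x
    rw [← inner_self_eq_zero (𝕜 := ℂ)]
    nth_rewrite 1 [hab]
    rw [inner_add_left, inner_smul_left, inner_smul_left, h5 i φ₀ hi, h5 j φ₁ hj]
    simp

end Clean

theorem corollary7 {H : Type*} [NormedAddCommGroup H] [InnerProductSpace ℂ H] [CompleteSpace H]
    (hH : Module.finrank ℂ H = 2) {I : Type*} [Fintype I] [Nontrivial I] (P : POVM H I) :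
    (P.IsClean ↔ P.IsRankOne ∨ ∃ t : Fin 3 → I, P.IsNonCollinearTriple t) ∧
    (∀ t : Fin 3 → I, P.IsNonCollinearTriple t ↔ P.IsFrameTriple t) ∧
    (P.IsClean → ∀ Q : POVM H I, P.CleannessEquivalent Q ↔ P.UnitarilyEquivalent Q) := by
  have rigid : (P.IsRankOne ∨ ∃ t : Fin 3 → I, P.IsNonCollinearTriple t) →
      ∀ Q : POVM H I, Q.IsCleaner P → P.UnitarilyEquivalent Q := by
    rintro (h | ⟨t, h⟩) Q hQ
    · exact (h.unitarilyEquivalent hH hQ).symm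
    · exact (h.unitarilyEquivalent hH hQ).symm
  refine ⟨⟨fun h => h.isRankOne_or_exists_triple hH, fun h Q hQ => (rigid h Q hQ).isCleaner⟩,
    P.isNonCollinearTriple_iff_isFrameTriple hH, fun h Q => ⟨fun hQ => ?_, fun hQ => ?_⟩⟩
  · exact rigid (h.isRankOne_or_exists_triple hH) Q hQ.1
  · exact ⟨hQ.symm.isCleaner, hQ.isCleaner⟩
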